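/- Let $M\ge 1$ and $K\ge 1$, and let $\rho_k\in[-1,1]$ and $\epsilon_k,\beta_k\ge 0$ for $k=1,\dots,K$. The channel vectors $\boldsymbol h_k(i)\in\mathbb C^M$ of the users $k=1,\dots,K$ in the blocks $i=0,1,2,\dots$ evolve by $$\boldsymbol h_k(i+1)=\rho_k\boldsymbol h_k(i)+\sqrt{1-\rho_k^2}\,\boldsymbol e_k(i),$$ where the initial channels $\boldsymbol h_k(0)$ and the innovations $\boldsymbol e_k(i)$, over all $k$ and $i$, are mutually independent with the circularly symmetric complex Gaussian law $\mathcal{CN}(0,\boldsymbol I_M)$. Fix a block $t$ and ages $n_1,\dots,n_K\in\{0,1,\dots,t\}$, and let the estimated channel matrix $\hat{\boldsymbol H}\in\mathbb C^{M\times K}$ have the columns $\hat{\boldsymbol h}_i=\boldsymbol h_i(t-n_i)$. Write $\boldsymbol h_k=\boldsymbol h_k(t)$, and let $\hat{\boldsymbol H}^*$ be the entrywise conjugate of $\hat{\boldsymbol H}$. For a random precoding matrix with columns $\boldsymbol v_1,\dots,\boldsymbol v_K$, the per-user SINR bound is defined as $$\gamma_k=\frac{\epsilon_k\beta_k|\mathbb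 E\,\boldsymbol h_k^T\boldsymbol v_k|^2}{1+\epsilon_k\beta_k\left(\mathbb E|\boldsymbol h_k^T\boldsymbol v_k|^2-|\mathbb E\,\boldsymbol h_k^T\boldsymbol v_k|^2\right)+\sum_{i\ne k}\epsilon_i\beta_i\,\mathbb E|\boldsymbol h_k^T\boldsymbol v_i|^2}.$$ Let $k$ be a user whose CSI has age $n=n_k$. (MF) For matched-filter precoding, $\boldsymbol V^{\mathrm{MF}}=\hat{\boldsymbol H}^*/\sqrt{\eta^{\mathrm{MF}}}$ with $\eta^{\mathrm{MF}}=\frac1K\mathbb E\,\mathrm{tr}(\hat{\boldsymbol H}^T\hat{\boldsymbol H}^*)$, all these expectations exist, $\eta^{\mathrm{MF}}=M$, and $$\gamma_k^{\mathrm{MF}}(n)=\frac{\epsilon_k\beta_kM\rho_k^{2n}}{1+\sum_{i=1}^K\epsilon_i\beta_i}.$$ (ZF) If $K<M$, then for zero-forcing precoding, $\boldsymbol V^{\mathrm{ZF}}=\hat{\boldsymbol H}^*(\hat{\boldsymbol H}^T\hat{\boldsymbol H}^*)^{-1}/\sqrt{\eta^{\mathrm{ZF}}}$ with $\eta^{\mathrm{ZF}}=\frac1K\mathbb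 E\,\mathrm{tr}\big((\hat{\boldsymbol H}^T\hat{\boldsymbol H}^*)^{-1}\big)$, the inverse exists almost surely, all these expectations exist, $\eta^{\mathrm{ZF}}=\frac1{M-K}$, and $$\gamma_k^{\mathrm{ZF}}(n)=\frac{\epsilon_k\beta_k(M-K)\rho_k^{2n}}{1+(1-\rho_k^{2n})\sum_{i=1}^K\epsilon_i\beta_i}.$$ -/

import Mathlib

open MeasureTheory ProbabilityTheory
open scoped Matrix

noncomputable section

namespace AgedCSI

/-- The law `CN(0, 1)` on `ℂ`: independent real and imaginary parts, each `N(0, 1/2)`. -/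
def complexGaussian : Measure ℂ :=
  ((gaussianReal 0 (1 / 2)).prod (gaussianReal 0 (1 / 2))).map
    (fun p : ℝ × ℝ => (⟨p.1, p.2⟩ : ℂ))

/-- The circularly symmetric complex Gaussian law `CN(0, I_M)` on `ℂ^M`:
its coordinates are independent with law `CN(0, 1)`. -/
def complexGaussianVec (M : ℕ) : Measure (Fin M → ℂ) :=
  Measure.pi (fun _ => complexGaussian)

/-- `h k i` is the small-scale fading vector of user `k` in block `i`, `e k i` the innovation.
The channels evolve as first-order stationary Gauss-Markov processes with temporal correlation
coefficients `ρ k`, started at `CN(0, I_M)` and driven by `CN(0, I_M)` innovations; the initial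
channels and the innovations of all users and blocks are mutually independent. -/
structure IsGaussMarkovChannel {Ω : Type*} [MeasurableSpace Ω] (P : Measure Ω) {M K : ℕ}
    (ρ : Fin K → ℝ) (h e : Fin K → ℕ → Ω → Fin M → ℂ) : Prop where
  law_init : ∀ k, HasLaw (h k 0) (complexGaussianVec M) P
  law_innovation : ∀ k i, HasLaw (e k i) (complexGaussianVec M) P
  indep : iIndepFun
    (Sum.elim (fun k => h k 0) (fun p => e p.1 p.2) :
      Fin K ⊕ Fin K × ℕ → Ω → Fin M → ℂ) P
  evolution : ∀ k i, ∀ᵐ ω ∂P, ∀ m, h k (i + 1) ω m =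
    (ρ k : ℂ) * h k i ω m + (Real.sqrt (1 - ρ k ^ 2) : ℂ) * e k i ω m

section

variable {Ω : Type*} {M K : ℕ}

/-- The estimated channel matrix (`M × K`) in block `t`: the column of user `i` is the channel
of that user `age i` blocks ago. -/
def estimate (h : Fin K → ℕ → Ω → Fin M → ℂ) (t : ℕ) (age : Fin K → ℕ) (ω : Ω) :
    Matrix (Fin M) (Fin K) ℂ :=
  Matrix.of fun m i => h i (t - age i) ω m

/-- Entrywise complex conjugate of a matrix. -/
def conjMat (A : Matrix (Fin M) (Fin K) ℂ) : Matrix (Fin M) (Fin K) ℂ :=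
  A.map (starRingEnd ℂ)

/-- The `K × K` matrix `Aᵀ A^*`, with `A^*` the entrywise conjugate. -/
def gram (A : Matrix (Fin M) (Fin K) ℂ) : Matrix (Fin K) (Fin K) ℂ :=
  Aᵀ * conjMat A

/-- The effective gain `hᵀ v_i`, where `v_i` is the `i`-th column of the precoding matrix. -/
def gain (hk : Ω → Fin M → ℂ) (V : Ω → Matrix (Fin M) (Fin K) ℂ) (i : Fin K) (ω : Ω) : ℂ :=
  hk ω ⬝ᵥ (fun m => V ω m i)

variable [MeasurableSpace Ω]

/-- Matched-filter normalization `(1/K) E tr(Ĥᵀ Ĥ^*)` (the trace is real). -/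
def mfNorm (P : Measure Ω) (Hhat : Ω → Matrix (Fin M) (Fin K) ℂ) : ℝ :=
  (1 / (K : ℝ)) * (∫ ω, (gram (Hhat ω)).trace ∂P).re

/-- Zero-forcing normalization `(1/K) E tr((Ĥᵀ Ĥ^*)⁻¹)` (the trace is real). -/
def zfNorm (P : Measure Ω) (Hhat : Ω → Matrix (Fin M) (Fin K) ℂ) : ℝ :=
  (1 / (K : ℝ)) * (∫ ω, ((gram (Hhat ω))⁻¹).trace ∂P).re

/-- Matched-filter precoding matrix `Ĥ^* / √η`. -/
def mfPrecoder (P : Measure Ω) (Hhat : Ω → Matrix (Fin M) (Fin K) ℂ) (ω : Ω) :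
    Matrix (Fin M) (Fin K) ℂ :=
  ((1 / Real.sqrt (mfNorm P Hhat) : ℝ) : ℂ) • conjMat (Hhat ω)

/-- Zero-forcing precoding matrix `Ĥ^* (Ĥᵀ Ĥ^*)⁻¹ / √η`. -/
def zfPrecoder (P : Measure Ω) (Hhat : Ω → Matrix (Fin M) (Fin K) ℂ) (ω : Ω) :
    Matrix (Fin M) (Fin K) ℂ :=
  ((1 / Real.sqrt (zfNorm P Hhat) : ℝ) : ℂ) • (conjMat (Hhat ω) * (gram (Hhat ω))⁻¹)

/-- The per-user SINR bound
`γ_k = ε_k β_k |E h_kᵀ v_k|² /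
  (1 + ε_k β_k (E|h_kᵀ v_k|² - |E h_kᵀ v_k|²) + ∑_{i ≠ k} ε_i β_i E|h_kᵀ v_i|²)`
of user `k` with channel `hk` under the precoding matrix `V`. -/
def sinr (P : Measure Ω) (ε β : Fin K → ℝ) (hk : Ω → Fin M → ℂ)
    (V : Ω → Matrix (Fin M) (Fin K) ℂ) (k : Fin K) : ℝ :=
  (ε k * β k * ‖∫ ω, gain hk V k ω ∂P‖ ^ 2) /
    (1 + ε k * β k * ((∫ ω, ‖gain hk V k ω‖ ^ 2 ∂P) - ‖∫ ω, gain hk V k ω ∂P‖ ^ 2)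
      + ∑ i ∈ Finset.univ.erase k, ε i * β i * ∫ ω, ‖gain hk V i ω‖ ^ 2 ∂P)

end

end AgedCSI

end

open MeasureTheory ProbabilityTheory
open scoped Matrix

namespace AgedCSI

/-! ### Complex Gaussian vectors: characteristic functions, unitary invariance, sums -/

section

/-! Unrolling the recursion over `n` blocks gives `h_k(t) = a x_k + R`, where `a = ρ_k ^ n`, `x_k`
is the estimated column of user `k`, and `R` has law `CN(0, (1 - a²) I)` and is independent of all
estimated columns jointly (`IsGaussMarkovChannel.exists_residual`). The columns themselves are
independent standard vectors, whatever their ages.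

A precoding column is a function `f(x)` of the estimate. As `R` is centred, white and independent of
`x`, the gain has mean `a E[x_k · f(x)]` and second moment `a² E|x_k · f(x)|² + (1 - a²) E‖f(x)‖²`
(`moments_gain`). Both normalizations make `E‖f(x)‖² = 1`.

For the matched filter, `E|x_k · conj x_i|²` is `M² + M` if `i = k` and `M` otherwise, so the second
moments are `M a² δ_{ik} + 1`. For zero forcing, `x_k · f_i(x)` is almost surely the constant `√(M -
K) δ_{ik}`, so they are `(M - K) a² δ_{ik} + (1 - a²)`. In both cases the part with `δ_{ik}` is the
squared mean, and `sinr_eq_of_moments` gives the SINR.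

The deep input for zero forcing is `E (G⁻¹)_{ii} = 1 / (M - K)` for the Gram matrix `G`. The entry
is the inverse squared distance of column `i` to the span of the others. With those fixed, unitary
invariance makes the squared distance a sum of `d = M - K + 1` independent `|z|²`. Integrating its
Laplace transform `(1 + s)⁻ᵈ` over `s > 0` gives the inverse moment `1 / (d - 1)`. -/

instance : IsProbabilityMeasure complexGaussian :=
  Measure.isProbabilityMeasure_map (by
    exact (Complex.measurableEquivRealProd.symm.measurable).aemeasurable)

instance (M : ℕ) : IsProbabilityMeasure (complexGaussianVec M) := by
  unfold complexGaussianVec; infer_instance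

lemma measurable_complexMk : Measurable (fun p : ℝ × ℝ => (⟨p.1, p.2⟩ : ℂ)) :=
  Complex.measurableEquivRealProd.symm.measurable

lemma measurableEmbedding_complexMk : MeasurableEmbedding (fun p : ℝ × ℝ => (⟨p.1, p.2⟩ : ℂ)) :=
  Complex.measurableEquivRealProd.symm.measurableEmbedding

lemma integral_complexGaussian {E : Type*} [NormedAddCommGroup E] [NormedSpace ℝ E] (f : ℂ → E) :
    ∫ z, f z ∂complexGaussian =
      ∫ p : ℝ × ℝ, f ⟨p.1, p.2⟩ ∂((gaussianReal 0 (1 / 2)).prod (gaussianReal 0 (1 / 2))) :=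
  measurableEmbedding_complexMk.integral_map _

lemma charFunDual_complexGaussian (L : StrongDual ℝ ℂ) :
    charFunDual complexGaussian L =
      Complex.exp (-(((L 1) ^ 2 + (L Complex.I) ^ 2 : ℝ) : ℂ) / 4) := by
  rw [charFunDual_apply, integral_complexGaussian]
  have key : ∀ p : ℝ × ℝ, Complex.exp ((L ⟨p.1, p.2⟩ : ℂ) * Complex.I) =
      Complex.exp ((L 1 : ℂ) * p.1 * Complex.I) *
        Complex.exp ((L Complex.I : ℂ) * p.2 * Complex.I) := by
    intro p
    have : (⟨p.1, p.2⟩ : ℂ) = p.1 • (1 : ℂ) + p.2 • Complex.I := by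
      apply Complex.ext <;> simp
    rw [this, map_add, map_smul, map_smul, ← Complex.exp_add]
    congr 1
    push_cast [smul_eq_mul]
    ring
  simp_rw [key]
  rw [integral_prod_mul (fun x : ℝ => Complex.exp ((L 1 : ℂ) * x * Complex.I))
    (fun y : ℝ => Complex.exp ((L Complex.I : ℂ) * y * Complex.I)),
    ← charFun_apply_real, ← charFun_apply_real, charFun_gaussianReal, charFun_gaussianReal,
    ← Complex.exp_add]
  congr 1
  push_cast
  ring

/-- The vector in `ℂ^M` which represents a real-linear functional as `z ↦ Re ⟪c, z⟫`. -/
noncomputable def dualVec {M : ℕ} (L : StrongDual ℝ (Fin M → ℂ)) : EuclideanSpace ℂ (Fin M) :=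
  WithLp.toLp 2 fun m => ⟨L (Pi.single m 1), L (Pi.single m Complex.I)⟩

lemma dual_apply_eq_re_inner {M : ℕ} (L : StrongDual ℝ (Fin M → ℂ)) (z : Fin M → ℂ) :
    L z = (inner ℂ (dualVec L) (WithLp.toLp 2 z)).re := by
  have hz : z = ∑ m, ((z m).re • (Pi.single m 1 : Fin M → ℂ) +
      (z m).im • (Pi.single m Complex.I : Fin M → ℂ)) := by
    ext j
    simp [Finset.sum_apply, Pi.single_apply, Finset.sum_add_distrib, Complex.re_add_im]
  conv_lhs => rw [hz]
  rw [map_sum, PiLp.inner_apply, Complex.re_sum]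
  refine Finset.sum_congr rfl fun m _ => ?_
  simp [dualVec]

lemma dualVec_eq_of_forall {M : ℕ} (L : StrongDual ℝ (Fin M → ℂ)) (c : EuclideanSpace ℂ (Fin M))
    (h : ∀ z : Fin M → ℂ, L z = (inner ℂ c (WithLp.toLp 2 z)).re) : dualVec L = c := by
  ext m
  simp only [dualVec, h]
  apply Complex.ext <;> simp [PiLp.inner_apply]

/-- The functional enters only through the norm of its representing vector; this is the source of
unitary invariance and of the additivity of variances. -/
lemma charFunDual_complexGaussianVec {M : ℕ} (L : StrongDual ℝ (Fin M → ℂ)) :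
    charFunDual (complexGaussianVec M) L =
      Complex.exp (-((‖dualVec L‖ ^ 2 : ℝ) : ℂ) / 4) := by
  rw [complexGaussianVec, charFunDual_pi]
  simp_rw [charFunDual_complexGaussian]
  rw [← Complex.exp_sum]
  congr 1
  rw [EuclideanSpace.norm_sq_eq]
  push_cast
  rw [← Finset.sum_div, Finset.sum_neg_distrib]
  congr 2
  refine Finset.sum_congr rfl fun m _ => ?_
  norm_cast
  rw [Complex.sq_norm, Complex.normSq_apply]
  simp [dualVec]
  ring

/-- The law `CN(0, I_M)` is invariant under unitary maps. -/
lemma measurePreserving_isometry {M : ℕ}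
    (Φ : EuclideanSpace ℂ (Fin M) ≃ₗᵢ[ℂ] EuclideanSpace ℂ (Fin M)) :
    MeasurePreserving (fun z : Fin M → ℂ => (Φ (WithLp.toLp 2 z)).ofLp)
      (complexGaussianVec M) (complexGaussianVec M) := by
  let A : (Fin M → ℂ) →L[ℝ] (Fin M → ℂ) :=
    ((EuclideanSpace.equiv (Fin M) ℂ).toContinuousLinearMap.comp
      (Φ.toContinuousLinearEquiv.toContinuousLinearMap.comp
        (EuclideanSpace.equiv (Fin M) ℂ).symm.toContinuousLinearMap)).restrictScalars ℝ
  have hA : ∀ z, A z = (Φ (WithLp.toLp 2 z)).ofLp := fun z => rfl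
  refine ⟨A.continuous.measurable, ?_⟩
  change Measure.map A _ = _
  have := Measure.isProbabilityMeasure_map (μ := complexGaussianVec M)
    A.continuous.measurable.aemeasurable
  refine Measure.ext_of_charFunDual ?_
  ext L
  rw [charFunDual_map, charFunDual_complexGaussianVec, charFunDual_complexGaussianVec]
  -- Composing with `Φ` moves the representing vector by the adjoint, which is the inverse for a
  -- unitary map.
  have : dualVec (L.comp A) = Φ.symm (dualVec L) := by
    apply dualVec_eq_of_forall
    intro z
    have := dual_apply_eq_re_inner L (A z)
    rw [ContinuousLinearMap.comp_apply, this, hA]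
    rw [← Φ.inner_map_map (Φ.symm (dualVec L)), LinearIsometryEquiv.apply_symm_apply]
  rw [this, LinearIsometryEquiv.norm_map]

/-- The law `CN(0, a² I_M)`. -/
noncomputable def scaledGaussianVec (M : ℕ) (a : ℝ) : Measure (Fin M → ℂ) :=
  (complexGaussianVec M).map (fun z => a • z)

lemma measurable_smulVec {M : ℕ} (a : ℝ) : Measurable (fun z : Fin M → ℂ => a • z) :=
  (continuous_const_smul a).measurable

instance (M : ℕ) (a : ℝ) : IsProbabilityMeasure (scaledGaussianVec M a) :=
  Measure.isProbabilityMeasure_map (measurable_smulVec a).aemeasurable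

lemma scaledGaussianVec_one (M : ℕ) : scaledGaussianVec M 1 = complexGaussianVec M := by
  simp [scaledGaussianVec]

lemma charFunDual_scaledGaussianVec {M : ℕ} (a : ℝ) (L : StrongDual ℝ (Fin M → ℂ)) :
    charFunDual (scaledGaussianVec M a) L =
      Complex.exp (-((a ^ 2 * ‖dualVec L‖ ^ 2 : ℝ) : ℂ) / 4) := by
  have h1 : scaledGaussianVec M a = (complexGaussianVec M).map
      (a • ContinuousLinearMap.id ℝ (Fin M → ℂ)) := rfl
  rw [h1, charFunDual_map, charFunDual_complexGaussianVec]
  have : dualVec (L.comp (a • ContinuousLinearMap.id ℝ (Fin M → ℂ))) = (a : ℂ) • dualVec L := by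
    apply dualVec_eq_of_forall
    intro z
    simp [dual_apply_eq_re_inner L z]
  rw [this, norm_smul, mul_pow]
  simp

lemma scaledGaussianVec_eq_of_sq_eq {M : ℕ} {a b : ℝ} (h : a ^ 2 = b ^ 2) :
    scaledGaussianVec M a = scaledGaussianVec M b := by
  refine Measure.ext_of_charFunDual ?_
  ext L
  rw [charFunDual_scaledGaussianVec, charFunDual_scaledGaussianVec, h]

variable {Ω : Type*} [MeasurableSpace Ω] {P : Measure Ω} {M : ℕ}

lemma hasLaw_add_of_indepFun [IsProbabilityMeasure P] {X Y : Ω → Fin M → ℂ} {a b c : ℝ}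
    (hX : HasLaw X (scaledGaussianVec M a) P) (hY : HasLaw Y (scaledGaussianVec M b) P)
    (hXY : IndepFun X Y P) (hc : c ^ 2 = a ^ 2 + b ^ 2) :
    HasLaw (X + Y) (scaledGaussianVec M c) P := by
  refine ⟨hX.aemeasurable.add hY.aemeasurable, ?_⟩
  have := Measure.isProbabilityMeasure_map (hX.aemeasurable.add hY.aemeasurable)
  refine Measure.ext_of_charFunDual ?_
  rw [hXY.charFunDual_map_add_eq_mul hX.aemeasurable hY.aemeasurable, hX.map_eq, hY.map_eq]
  ext L
  rw [Pi.mul_apply, charFunDual_scaledGaussianVec, charFunDual_scaledGaussianVec,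
    charFunDual_scaledGaussianVec, hc, ← Complex.exp_add]
  congr 1
  push_cast
  ring

lemma hasLaw_smul {X : Ω → Fin M → ℂ} {a b c : ℝ}
    (hX : HasLaw X (scaledGaussianVec M a) P) (hc : c ^ 2 = (b * a) ^ 2) :
    HasLaw (fun ω => b • X ω) (scaledGaussianVec M c) P := by
  refine ⟨(measurable_smulVec b).comp_aemeasurable hX.aemeasurable, ?_⟩
  have : (fun ω => b • X ω) = (fun z => b • z) ∘ X := rfl
  rw [this, ← AEMeasurable.map_map_of_aemeasurable (measurable_smulVec b).aemeasurable
    hX.aemeasurable, hX.map_eq, scaledGaussianVec_eq_of_sq_eq hc, scaledGaussianVec,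
    Measure.map_map (measurable_smulVec b) (measurable_smulVec a), scaledGaussianVec]
  congr 1
  ext z : 1
  simp [mul_smul]

lemma integrable_pow_gaussianReal (n : ℕ) (v : NNReal) :
    Integrable (fun x : ℝ => x ^ n) (gaussianReal 0 v) := by
  have := (memLp_id_gaussianReal (μ := 0) (v := v) (n : NNReal)).integrable_norm_pow'
  refine (integrable_norm_iff (by fun_prop)).1 ?_
  simpa using this

lemma integral_sq_gaussianReal_half : ∫ x, x ^ 2 ∂gaussianReal 0 (1 / 2) = 1 / 2 := by
  have := variance_id_gaussianReal (μ := 0) (v := 1 / 2)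
  rw [variance_of_integral_eq_zero (by fun_prop) (by simp)] at this
  simpa using this

/-- Write `m` for the moment. The law `N(0, 1)` is both the image of `N(0, 1/2)` under
multiplication by `√2` and its convolution square. Hence its fourth moment is both `4 m` and `2 m +
3/2`. -/
lemma integral_pow_four_gaussianReal_half :
    ∫ x, x ^ 4 ∂gaussianReal 0 (1 / 2) = 3 / 4 := by
  set γ := gaussianReal 0 (1 / 2) with hγ
  have h1 : ∫ x, x ∂γ = 0 := by simp [hγ]
  have h2 : ∫ x, x ^ 2 ∂γ = 1 / 2 := integral_sq_gaussianReal_half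
  have hint := integrable_pow_gaussianReal
  have e1 : ∫ x, x ^ 4 ∂gaussianReal 0 1 = 4 * ∫ x, x ^ 4 ∂γ := by
    have : gaussianReal 0 1 = γ.map (fun x => √2 * x) := by
      rw [hγ, gaussianReal_map_const_mul]
      congr 1
      · simp
      · ext
        simp
    rw [this, integral_map (by fun_prop) (by fun_prop), ← integral_const_mul]
    congr 1
    ext x
    rw [mul_pow, show (√2) ^ 4 = (√2 ^ 2) ^ 2 by ring, Real.sq_sqrt (by norm_num)]
    norm_num
  have e2 : ∫ x, x ^ 4 ∂gaussianReal 0 1 = 2 * (∫ x, x ^ 4 ∂γ) + 6 * (1 / 2) * (1 / 2) := by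
    have hc : gaussianReal 0 1 = γ ∗ γ := by
      rw [hγ, gaussianReal_conv_gaussianReal]
      congr 1
      · simp
      · exact (add_halves 1).symm
    rw [hc, integral_conv (by rw [← hc]; exact hint 4 _)]
    have inner : ∀ x, ∫ y, (x + y) ^ 4 ∂γ = x ^ 4 + 3 * x ^ 2 + ∫ y, y ^ 4 ∂γ := by
      intro x
      have h3 : ∫ y, y ^ 3 ∂γ = 0 := by
        have : γ = γ.map (fun x => -x) := by rw [hγ, gaussianReal_map_neg]; simp
        have h : ∫ y, y ^ 3 ∂γ = - ∫ y, y ^ 3 ∂γ := by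
          conv_lhs => rw [this]
          rw [integral_map (by fun_prop) (by fun_prop), ← integral_neg]
          congr 1
          ext y
          ring
        linarith
      have : ∀ y : ℝ, (x + y) ^ 4 =
          x ^ 4 + (4 * x ^ 3) * y ^ 1 + (6 * x ^ 2) * y ^ 2 + (4 * x) * y ^ 3 + y ^ 4 := by
        intro y; ring
      simp_rw [this]
      rw [integral_add, integral_add, integral_add, integral_add, integral_const_mul,
        integral_const_mul, integral_const_mul, h2, h3]
      · simp [h1]
        ring
      all_goals first
        | exact integrable_const _
        | exact (hint _ _).const_mul _
        | exact hint _ _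
        | skip
      · exact (integrable_const _).add ((hint _ _).const_mul _)
      · exact ((integrable_const _).add ((hint _ _).const_mul _)).add ((hint _ _).const_mul _)
      · exact (((integrable_const _).add ((hint _ _).const_mul _)).add
          ((hint _ _).const_mul _)).add ((hint _ _).const_mul _)
    simp_rw [inner]
    rw [integral_add, integral_add, integral_const_mul, h2]
    · simp
      ring
    · exact hint _ _
    · exact (hint _ _).const_mul _
    · exact (hint _ _).add ((hint _ _).const_mul _)
    · exact integrable_const _
  linarith

end

/-! ### Laplace transforms and inverse moments -/

lemma integral_exp_neg_mul_sq_gaussianReal_half {s : ℝ} (hs : 0 ≤ s) :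
    ∫ x, Real.exp (-s * x ^ 2) ∂gaussianReal 0 (1 / 2) = (√(1 + s))⁻¹ := by
  rw [integral_gaussianReal_eq_integral_smul (by norm_num)]
  have : ∀ x : ℝ, gaussianPDFReal 0 (1 / 2) x • Real.exp (-s * x ^ 2) =
      (√Real.pi)⁻¹ * Real.exp (-(1 + s) * x ^ 2) := by
    intro x
    rw [gaussianPDFReal_def, smul_eq_mul, mul_assoc, ← Real.exp_add]
    congr 3
    · push_cast; ring
    · push_cast; ring
  simp_rw [this]
  rw [integral_const_mul, integral_gaussian, Real.sqrt_div Real.pi_pos.le]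
  have : √Real.pi ≠ 0 := (Real.sqrt_pos.2 Real.pi_pos).ne'
  field_simp

lemma integral_exp_neg_mul_normSq_complexGaussian {s : ℝ} (hs : 0 ≤ s) :
    ∫ z, Real.exp (-s * ‖z‖ ^ 2) ∂complexGaussian = (1 + s)⁻¹ := by
  rw [integral_complexGaussian]
  have : ∀ p : ℝ × ℝ, Real.exp (-s * ‖(⟨p.1, p.2⟩ : ℂ)‖ ^ 2) =
      Real.exp (-s * p.1 ^ 2) * Real.exp (-s * p.2 ^ 2) := by
    intro p
    rw [Complex.sq_norm, Complex.normSq_apply, ← Real.exp_add]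
    congr 1
    ring
  simp_rw [this]
  rw [integral_prod_mul (fun x : ℝ => Real.exp (-s * x ^ 2)) (fun y : ℝ => Real.exp (-s * y ^ 2)),
    integral_exp_neg_mul_sq_gaussianReal_half hs, ← mul_inv, Real.mul_self_sqrt (by linarith)]

lemma lintegral_exp_neg_mul_sum_normSq {M : ℕ} (S : Finset (Fin M)) {s : ℝ} (hs : 0 ≤ s) :
    ∫⁻ z, ENNReal.ofReal (Real.exp (-s * ∑ i ∈ S, ‖z i‖ ^ 2)) ∂complexGaussianVec M =
      ENNReal.ofReal ((1 + s)⁻¹ ^ S.card) := by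
  rw [← ofReal_integral_eq_lintegral_ofReal]
  · congr 1
    have : ∀ z : Fin M → ℂ, Real.exp (-s * ∑ i ∈ S, ‖z i‖ ^ 2) =
        ∏ i, (if i ∈ S then Real.exp (-s * ‖z i‖ ^ 2) else 1) := by
      intro z
      rw [Finset.mul_sum, Real.exp_sum, Finset.prod_ite_mem, Finset.univ_inter]
    simp_rw [this]
    rw [complexGaussianVec,
      integral_fintype_prod_eq_prod
        (fun (i : Fin M) (w : ℂ) => if i ∈ S then Real.exp (-s * ‖w‖ ^ 2) else 1)]
    have : ∀ i : Fin M, ∫ w, (if i ∈ S then Real.exp (-s * ‖w‖ ^ 2) else 1) ∂complexGaussian =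
        if i ∈ S then (1 + s)⁻¹ else 1 := by
      intro i
      split_ifs
      · exact integral_exp_neg_mul_normSq_complexGaussian hs
      · simp
    simp_rw [this]
    rw [Finset.prod_ite_mem, Finset.univ_inter, Finset.prod_const]
  · refine Integrable.of_bound (C := 1) ?_ ?_
    · exact (Continuous.measurable (by fun_prop)).aestronglyMeasurable
    · refine .of_forall fun z => ?_
      rw [Real.norm_eq_abs, Real.abs_exp, Real.exp_le_one_iff]
      have : 0 ≤ ∑ i ∈ S, ‖z i‖ ^ 2 := Finset.sum_nonneg fun _ _ => by positivity
      nlinarith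
  · exact .of_forall fun z => (Real.exp_pos _).le

/-- In `ENNReal` this also holds at `x = 0`, where both sides are `⊤`; no null set has to be removed
later. -/
lemma lintegral_exp_neg_mul {x : ℝ} (hx : 0 ≤ x) :
    ∫⁻ s in Set.Ioi (0 : ℝ), ENNReal.ofReal (Real.exp (-s * x)) = (ENNReal.ofReal x)⁻¹ := by
  rcases hx.eq_or_lt with rfl | hx
  · simp
  · have h : ∀ s : ℝ, Real.exp (-s * x) = Real.exp (-x * s) := fun s => by ring_nf
    simp_rw [h]
    rw [← ofReal_integral_eq_lintegral_ofReal]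
    · rw [integral_exp_mul_Ioi (by linarith), ← ENNReal.ofReal_inv_of_pos hx]
      congr 1
      simp
    · exact integrableOn_exp_mul_Ioi (by linarith) 0
    · exact .of_forall fun z => (Real.exp_pos _).le

/-- A primitive is `-(1 + s) ^ (1 - d) / (d - 1)`; for `d = 1` the integral diverges. -/
lemma lintegral_one_add_inv_pow {d : ℕ} (hd : 2 ≤ d) :
    ∫⁻ s in Set.Ioi (0 : ℝ), ENNReal.ofReal ((1 + s)⁻¹ ^ d) =
      ENNReal.ofReal (1 / ((d : ℝ) - 1)) := by
  have hd' : (1 : ℝ) < d := by exact_mod_cast hd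
  have hderiv : ∀ s ∈ Set.Ici (0 : ℝ),
      HasDerivAt (fun s : ℝ => -(1 + s) ^ (1 - (d : ℝ)) / (d - 1)) ((1 + s)⁻¹ ^ d) s := by
    intro s hs
    have hs' : 0 < 1 + s := by have : (0 : ℝ) ≤ s := hs; linarith
    have h1 : HasDerivAt (fun s : ℝ => (1 + s) ^ (1 - (d : ℝ)))
        (1 * (1 - (d : ℝ)) * (1 + s) ^ (1 - (d : ℝ) - 1)) s :=
      ((hasDerivAt_id s).const_add 1).rpow_const (Or.inl hs'.ne')
    refine (h1.neg.div_const ((d : ℝ) - 1)).congr_deriv ?_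
    rw [show 1 - (d : ℝ) - 1 = -d by ring, Real.rpow_neg hs'.le, Real.rpow_natCast, inv_pow]
    have : (d : ℝ) - 1 ≠ 0 := by linarith
    field_simp
    ring
  have hlim : Filter.Tendsto (fun s : ℝ => -(1 + s) ^ (1 - (d : ℝ)) / (d - 1)) Filter.atTop
      (nhds 0) := by
    have h1 : Filter.Tendsto (fun s : ℝ => (1 + s) ^ (-((d : ℝ) - 1))) Filter.atTop (nhds 0) :=
      (tendsto_rpow_neg_atTop (by linarith)).comp
        (Filter.tendsto_atTop_add_const_left _ 1 Filter.tendsto_id)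
    have := (h1.neg).div_const ((d : ℝ) - 1)
    simpa using this
  have hpos : ∀ s ∈ Set.Ioi (0 : ℝ), 0 ≤ (1 + s)⁻¹ ^ d := by
    intro s hs
    have : (0 : ℝ) < s := hs
    positivity
  rw [← ofReal_integral_eq_lintegral_ofReal]
  · rw [integral_Ioi_of_hasDerivAt_of_nonneg' hderiv hpos hlim]
    congr 1
    simp
    ring
  · exact integrableOn_Ioi_deriv_of_nonneg' hderiv hpos hlim
  · exact (ae_restrict_iff' measurableSet_Ioi).2 (.of_forall hpos)

/-- The inverse moment of a Gamma distributed squared norm of `#S` coordinates. -/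
lemma lintegral_inv_sum_normSq {M : ℕ} (S : Finset (Fin M)) (hS : 2 ≤ S.card) :
    ∫⁻ z, (ENNReal.ofReal (∑ i ∈ S, ‖z i‖ ^ 2))⁻¹ ∂complexGaussianVec M =
      ENNReal.ofReal (1 / ((S.card : ℝ) - 1)) := by
  have : ∀ z : Fin M → ℂ, (ENNReal.ofReal (∑ i ∈ S, ‖z i‖ ^ 2))⁻¹ =
      ∫⁻ s in Set.Ioi (0 : ℝ), ENNReal.ofReal (Real.exp (-s * ∑ i ∈ S, ‖z i‖ ^ 2)) := fun z =>
    (lintegral_exp_neg_mul (Finset.sum_nonneg fun _ _ => by positivity)).symm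
  simp_rw [this]
  -- Tonelli turns the inverse moment into the integral of the Laplace transform.
  rw [lintegral_lintegral_swap, ← lintegral_one_add_inv_pow hS]
  · exact setLIntegral_congr_fun measurableSet_Ioi fun s hs =>
      lintegral_exp_neg_mul_sum_normSq S (le_of_lt hs)
  · refine Measurable.aemeasurable ?_
    refine ENNReal.measurable_ofReal.comp ?_
    exact Continuous.measurable (by fun_prop)

/-- The inverse moment of the squared distance of a Gaussian vector to a fixed subspace. -/
lemma lintegral_inv_norm_projection_sq {M : ℕ} (W : Submodule ℂ (EuclideanSpace ℂ (Fin M)))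
    (hW : Module.finrank ℂ W + 2 ≤ M) :
    ∫⁻ z : Fin M → ℂ, (ENNReal.ofReal (‖Wᗮ.orthogonalProjectionOnto (WithLp.toLp 2 z)‖ ^ 2))⁻¹
      ∂complexGaussianVec M =
      ENNReal.ofReal (1 / ((M : ℝ) - Module.finrank ℂ W - 1)) := by
  set d := Module.finrank ℂ Wᗮ with hd
  have hdim : Module.finrank ℂ W + d = M := by
    rw [hd, Submodule.finrank_add_finrank_orthogonal, finrank_euclideanSpace_fin]
  have hdM : d ≤ M := by omega
  let b := stdOrthonormalBasis ℂ Wᗮ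
  let S : Finset (Fin M) := Finset.univ.map (Fin.castLEEmb hdM)
  have hScard : S.card = d := by simp [S]
  let v : Fin M → EuclideanSpace ℂ (Fin M) := fun i =>
    if h : (i : ℕ) < d then (b ⟨i, h⟩ : EuclideanSpace ℂ (Fin M)) else 0
  have hv : ∀ j : Fin d, v (Fin.castLE hdM j) = b j := fun j => by simp [v]
  have hon : Orthonormal ℂ ((S : Set (Fin M)).domRestrict v) := by
    have hb : Orthonormal ℂ (fun j => (b j : EuclideanSpace ℂ (Fin M))) :=
      b.orthonormal.comp_linearIsometry Wᗮ.subtypeₗᵢ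
    have hS : ∀ i : (S : Set (Fin M)), ((i : Fin M) : ℕ) < d := by
      rintro ⟨i, hi⟩
      obtain ⟨j, -, rfl⟩ := Finset.mem_map.1 (Finset.mem_coe.1 hi)
      simp
    have heq : (S : Set (Fin M)).domRestrict v =
        (fun j => (b j : EuclideanSpace ℂ (Fin M))) ∘ fun i : (S : Set (Fin M)) => (⟨(i : Fin M), hS i⟩ : Fin d) := by
      ext1 i
      simp [v, hS i]
    rw [heq]
    refine hb.comp _ ?_
    intro i j hij
    ext
    simpa using hij
  obtain ⟨B, hB⟩ := hon.exists_orthonormalBasis_extension_of_card_eq (by simp)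
  have hproj : ∀ z : EuclideanSpace ℂ (Fin M),
      ‖Wᗮ.orthogonalProjectionOnto z‖ ^ 2 = ∑ i ∈ S, ‖(B.repr z).ofLp i‖ ^ 2 := by
    intro z
    rw [← b.sum_sq_norm_inner_right, Finset.sum_map]
    refine Finset.sum_congr rfl fun j _ => ?_
    rw [B.repr_apply_apply, hB _ (by simp [S])]
    change _ = ‖inner ℂ (v (Fin.castLE hdM j)) z‖ ^ 2
    rw [hv, Submodule.inner_orthogonalProjectionOnto_eq_of_mem_left]
  simp_rw [hproj]
  -- Unitary invariance: `B.repr` rotates `Wᗮ` onto the coordinate subspace of `S`.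
  have hmp := measurePreserving_isometry B.repr
  rw [hmp.lintegral_comp (f := fun w : Fin M → ℂ => (ENNReal.ofReal (∑ i ∈ S, ‖w i‖ ^ 2))⁻¹),
    lintegral_inv_sum_normSq S (by omega), hScard]
  · congr 2
    have : (Module.finrank ℂ W : ℝ) + d = M := by exact_mod_cast hdim
    linarith
  · exact (ENNReal.measurable_ofReal.comp (Continuous.measurable (by fun_prop))).inv

/-! ### Moments of complex Gaussian vectors and of white vectors -/

section

/-- Exponent 4 is needed because the matched filter produces `‖x_k‖²`, which must be square
integrable. -/
lemma memLp_id_complexGaussian : MemLp (fun z : ℂ => z) 4 complexGaussian := by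
  rw [complexGaussian, memLp_map_measure_iff (by fun_prop) measurable_complexMk.aemeasurable]
  have h : (fun x : ℝ => (x : ℂ)) = fun x => ((id x : ℝ) : ℂ) := rfl
  have h0 : MemLp (fun x : ℝ => (x : ℂ)) 4 (gaussianReal 0 (1 / 2)) := by
    rw [h]
    exact (memLp_id_gaussianReal' 4 (by simp)).ofReal
  have h1 := h0.comp_fst (gaussianReal 0 (1 / 2))
  have h2 := (h0.comp_snd (gaussianReal 0 (1 / 2))).const_mul Complex.I
  refine (h1.add h2).congr_norm (by exact measurable_complexMk.aestronglyMeasurable) ?_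
  refine .of_forall fun p => ?_
  congr 1
  apply Complex.ext <;> simp

lemma integral_id_complexGaussian : ∫ z, z ∂complexGaussian = 0 := by
  have hi : Integrable (fun x : ℝ => (x : ℂ)) (gaussianReal 0 (1 / 2)) :=
    ((memLp_id_gaussianReal 1).integrable (by simp)).ofReal
  have h0 : ∫ x : ℝ, (x : ℂ) ∂(gaussianReal 0 (1 / 2)) = 0 := by
    rw [integral_complex_ofReal]; simp
  rw [integral_complexGaussian]
  have : ∀ p : ℝ × ℝ, (⟨p.1, p.2⟩ : ℂ) = p.1 * (1 : ℂ) + (1 : ℂ) * (p.2 * Complex.I) := by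
    intro p
    apply Complex.ext <;> simp
  simp_rw [this]
  rw [integral_add, integral_prod_mul (fun x : ℝ => (x : ℂ)) (fun _ : ℝ => (1 : ℂ)),
    integral_prod_mul (fun _ : ℝ => (1 : ℂ)) (fun x : ℝ => (x : ℂ) * Complex.I),
    integral_mul_const, h0]
  · simp
  · exact hi.mul_prod (integrable_const _)
  · exact Integrable.mul_prod (f := fun _ : ℝ => (1 : ℂ)) (integrable_const _) (hi.mul_const _)

lemma integral_normSq_complexGaussian : ∫ z, ‖z‖ ^ 2 ∂complexGaussian = 1 := by
  rw [integral_complexGaussian]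
  have : ∀ p : ℝ × ℝ, ‖(⟨p.1, p.2⟩ : ℂ)‖ ^ 2 = p.1 ^ 2 * 1 + 1 * p.2 ^ 2 := by
    intro p
    rw [Complex.sq_norm, Complex.normSq_apply]
    ring
  simp_rw [this]
  rw [integral_add, integral_prod_mul (fun x : ℝ => x ^ 2) (fun _ : ℝ => (1 : ℝ)),
    integral_prod_mul (fun _ : ℝ => (1 : ℝ)) (fun x : ℝ => x ^ 2), integral_sq_gaussianReal_half]
  · simp
    norm_num
  · exact (integrable_pow_gaussianReal 2 _).mul_prod (integrable_const _)
  · exact Integrable.mul_prod (f := fun _ : ℝ => (1 : ℝ)) (integrable_const _)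
      (integrable_pow_gaussianReal 2 _)

lemma integral_norm_pow_four_complexGaussian : ∫ z, (‖z‖ ^ 2) ^ 2 ∂complexGaussian = 2 := by
  rw [integral_complexGaussian]
  have : ∀ p : ℝ × ℝ, (‖(⟨p.1, p.2⟩ : ℂ)‖ ^ 2) ^ 2 =
      p.1 ^ 4 * 1 + (2 * p.1 ^ 2) * p.2 ^ 2 + 1 * p.2 ^ 4 := by
    intro p
    rw [Complex.sq_norm, Complex.normSq_apply]
    ring
  simp_rw [this]
  have i1 : Integrable (fun p : ℝ × ℝ => p.1 ^ 4 * 1)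
      ((gaussianReal 0 (1 / 2)).prod (gaussianReal 0 (1 / 2))) :=
    (integrable_pow_gaussianReal 4 _).mul_prod (integrable_const _)
  have i2 : Integrable (fun p : ℝ × ℝ => (2 * p.1 ^ 2) * p.2 ^ 2)
      ((gaussianReal 0 (1 / 2)).prod (gaussianReal 0 (1 / 2))) :=
    ((integrable_pow_gaussianReal 2 _).const_mul 2).mul_prod (integrable_pow_gaussianReal 2 _)
  have i3 : Integrable (fun p : ℝ × ℝ => 1 * p.2 ^ 4)
      ((gaussianReal 0 (1 / 2)).prod (gaussianReal 0 (1 / 2))) :=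
    Integrable.mul_prod (integrable_const _) (integrable_pow_gaussianReal 4 _)
  have i12 : Integrable (fun p : ℝ × ℝ => p.1 ^ 4 * 1 + (2 * p.1 ^ 2) * p.2 ^ 2)
      ((gaussianReal 0 (1 / 2)).prod (gaussianReal 0 (1 / 2))) := i1.add i2
  rw [integral_add i12 i3, integral_add i1 i2,
    integral_prod_mul (fun x : ℝ => x ^ 4) (fun _ : ℝ => (1 : ℝ)),
    integral_prod_mul (fun _ : ℝ => (1 : ℝ)) (fun x : ℝ => x ^ 4),
    integral_prod_mul (fun x : ℝ => 2 * x ^ 2) (fun x : ℝ => x ^ 2), integral_const_mul,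
    integral_sq_gaussianReal_half, integral_pow_four_gaussianReal_half]
  simp
  norm_num

variable {Ω : Type*} [MeasurableSpace Ω] {P : Measure Ω} {M : ℕ}

lemma hasLaw_eval {X : Ω → Fin M → ℂ} (hX : HasLaw X (complexGaussianVec M) P) (m : Fin M) :
    HasLaw (fun ω => X ω m) complexGaussian P :=
  (measurePreserving_eval (fun _ : Fin M => complexGaussian) m).hasLaw.comp hX

lemma memLp_of_hasLaw {F : Type*} [MeasurableSpace F] {E : Type*} [NormedAddCommGroup E]
    {X : Ω → F} {μ : Measure F} (hX : HasLaw X μ P) {f : F → E} {p : ENNReal} (hf : MemLp f p μ) :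
    MemLp (fun ω => f (X ω)) p P := by
  rw [← hX.map_eq] at hf
  exact hf.comp_of_map hX.aemeasurable

lemma memLp_eval {X : Ω → Fin M → ℂ} (hX : HasLaw X (complexGaussianVec M) P) (m : Fin M) :
    MemLp (fun ω => X ω m) 4 P :=
  memLp_of_hasLaw (hasLaw_eval hX m) memLp_id_complexGaussian

lemma integral_eval {X : Ω → Fin M → ℂ} (hX : HasLaw X (complexGaussianVec M) P) (m : Fin M) :
    ∫ ω, X ω m ∂P = 0 := by
  rw [(hasLaw_eval hX m).integral_eq, integral_id_complexGaussian]

lemma integral_normSq_eval {X : Ω → Fin M → ℂ} (hX : HasLaw X (complexGaussianVec M) P)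
    (m : Fin M) : ∫ ω, ‖X ω m‖ ^ 2 ∂P = 1 := by
  have := (hasLaw_eval hX m).integral_comp (f := fun z => ‖z‖ ^ 2) (by fun_prop)
  rw [← integral_normSq_complexGaussian, ← this]
  rfl

lemma indepFun_eval {X : Ω → Fin M → ℂ} (hX : HasLaw X (complexGaussianVec M) P)
    {m m' : Fin M} (h : m ≠ m') : IndepFun (fun ω => X ω m) (fun ω => X ω m') P := by
  have := hX.isProbabilityMeasure
  have key : iIndepFun (fun m ω => X ω m) P := by
    rw [iIndepFun_iff_map_fun_eq_pi_map fun m => (hasLaw_eval hX m).aemeasurable]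
    simp_rw [(hasLaw_eval hX _).map_eq]
    exact hX.map_eq
  exact key.indepFun h

lemma integral_eval_mul_conj {X : Ω → Fin M → ℂ} (hX : HasLaw X (complexGaussianVec M) P)
    (m m' : Fin M) :
    ∫ ω, X ω m * (starRingEnd ℂ) (X ω m') ∂P = if m = m' then 1 else 0 := by
  split_ifs with h
  · subst h
    simp_rw [Complex.mul_conj']
    have := integral_normSq_eval hX m
    rw [← Complex.ofReal_one, ← this, ← integral_complex_ofReal]
    simp
  · rw [(indepFun_eval hX h).integral_fun_comp_mul_comp (f := fun z => z)
      (g := fun z => (starRingEnd ℂ) z) (hasLaw_eval hX m).aemeasurable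
      (hasLaw_eval hX m').aemeasurable (by fun_prop)
      (Complex.continuous_conj.measurable.aestronglyMeasurable), integral_eval hX, zero_mul]

lemma memLp_normSq_eval {X : Ω → Fin M → ℂ} (hX : HasLaw X (complexGaussianVec M) P)
    (m : Fin M) : MemLp (fun ω => ‖X ω m‖ ^ 2) 2 P := by
  have := hX.isProbabilityMeasure
  have h := memLp_eval hX m
  refine (memLp_two_iff_integrable_sq (h.1.norm.pow 2)).2 ?_
  refine (h.integrable_norm_pow (p := 4) (by norm_num)).congr (.of_forall fun ω => ?_)
  exact pow_mul ‖X ω m‖ 2 2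

lemma memLp_sum_normSq {X : Ω → Fin M → ℂ} (hX : HasLaw X (complexGaussianVec M) P) :
    MemLp (fun ω => ∑ m, ‖X ω m‖ ^ 2) 2 P :=
  memLp_finsetSum _ fun m _ => memLp_normSq_eval hX m

/-- Every pair of coordinates contributes `1`, and each diagonal pair one more because `E|z|⁴ = 2`.
-/
lemma integral_sum_normSq_sq {X : Ω → Fin M → ℂ} (hX : HasLaw X (complexGaussianVec M) P) :
    ∫ ω, (∑ m, ‖X ω m‖ ^ 2) ^ 2 ∂P = (M : ℝ) ^ 2 + M := by
  simp_rw [sq (∑ m, _), Finset.sum_mul_sum]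
  have hint : ∀ i j, Integrable (fun ω => ‖X ω i‖ ^ 2 * ‖X ω j‖ ^ 2) P := fun i j =>
    (memLp_normSq_eval hX i).integrable_mul (memLp_normSq_eval hX j)
  rw [integral_finsetSum _ fun i _ => integrable_finsetSum _ fun j _ => hint i j]
  simp_rw [integral_finsetSum _ fun j _ => hint _ j]
  have hval : ∀ i j, ∫ ω, ‖X ω i‖ ^ 2 * ‖X ω j‖ ^ 2 ∂P = 1 + if i = j then 1 else 0 := by
    intro i j
    split_ifs with h
    · subst h
      have := (hasLaw_eval hX i).integral_comp (f := fun z => (‖z‖ ^ 2) ^ 2) (by fun_prop)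
      rw [integral_norm_pow_four_complexGaussian] at this
      simp_rw [← sq]
      rw [one_add_one_eq_two, ← this]
      rfl
    · rw [(indepFun_eval hX h).integral_fun_comp_mul_comp (f := fun z => ‖z‖ ^ 2)
        (g := fun z => ‖z‖ ^ 2) (hasLaw_eval hX i).aemeasurable
        (hasLaw_eval hX j).aemeasurable (by fun_prop) (by fun_prop), integral_normSq_eval hX,
        integral_normSq_eval hX]
      simp
  simp_rw [hval]
  simp [Finset.sum_add_distrib]
  ring

/-- Centred random vectors with covariance `v I` and finite variance. -/
structure IsWhite (R : Ω → Fin M → ℂ) (v : ℝ) (P : Measure Ω) : Prop where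
  aemeasurable : AEMeasurable R P
  memLp : ∀ m, MemLp (fun ω => R ω m) 2 P
  integral_eq_zero : ∀ m, ∫ ω, R ω m ∂P = 0
  integral_mul_conj : ∀ m m', ∫ ω, R ω m * (starRingEnd ℂ) (R ω m') ∂P =
    if m = m' then (v : ℂ) else 0

lemma isWhite_of_hasLaw {R : Ω → Fin M → ℂ} {c : ℝ}
    (hR : HasLaw R (scaledGaussianVec M c) P) : IsWhite R (c ^ 2) P := by
  have hid : HasLaw id (complexGaussianVec M) (complexGaussianVec M) := HasLaw.id
  have h1 : ∀ m, MemLp (fun z : Fin M → ℂ => z m) 2 (scaledGaussianVec M c) := by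
    intro m
    rw [scaledGaussianVec, memLp_map_measure_iff
      (measurable_pi_apply m).aestronglyMeasurable (measurable_smulVec c).aemeasurable]
    exact (((memLp_eval hid m).mono_exponent (by norm_num)).const_mul (c : ℂ))
  refine ⟨hR.aemeasurable, fun m => memLp_of_hasLaw hR (h1 m), fun m => ?_, fun m m' => ?_⟩
  · have := hR.integral_comp (f := fun z => z m) (h1 m).1
    change ∫ ω, ((fun z => z m) ∘ R) ω ∂P = 0
    rw [this, scaledGaussianVec, integral_map (measurable_smulVec c).aemeasurable
      (measurable_pi_apply m).aestronglyMeasurable]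
    simp_rw [Pi.smul_apply]
    have := integral_eval hid m
    simp only [id] at this
    rw [integral_smul, this, smul_zero]
  · have hc : Continuous (fun z : Fin M → ℂ => z m * (starRingEnd ℂ) (z m')) := by fun_prop
    have := hR.integral_comp (f := fun z => z m * (starRingEnd ℂ) (z m'))
      hc.measurable.aestronglyMeasurable
    change ∫ ω, ((fun z => z m * (starRingEnd ℂ) (z m')) ∘ R) ω ∂P = _
    rw [this, scaledGaussianVec, integral_map (measurable_smulVec c).aemeasurable
      hc.measurable.aestronglyMeasurable]
    have h2 : ∀ z : Fin M → ℂ, (c • z) m * (starRingEnd ℂ) ((c • z) m') =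
        ((c ^ 2 : ℝ) : ℂ) * (z m * (starRingEnd ℂ) (z m')) := by
      intro z
      simp
      ring
    simp_rw [h2]
    have := integral_eval_mul_conj hid m m'
    simp only [id] at this
    rw [integral_const_mul, this]
    simp

/-- First and second moments of `X + Rᵀ V` for a white vector `R` independent of `(X, V)`. -/
lemma moments_add_dotProduct_of_indepFun [IsProbabilityMeasure P] {R V : Ω → Fin M → ℂ}
    {X : Ω → ℂ} {v : ℝ}
    (hR : IsWhite R v P) (hX : MemLp X 2 P) (hV : ∀ m, MemLp (fun ω => V ω m) 2 P)
    (hind : IndepFun R (fun ω => (X ω, V ω)) P) :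
    MemLp (fun ω => X ω + R ω ⬝ᵥ V ω) 2 P ∧
    ∫ ω, X ω + R ω ⬝ᵥ V ω ∂P = ∫ ω, X ω ∂P ∧
    ∫ ω, ‖X ω + R ω ⬝ᵥ V ω‖ ^ 2 ∂P = ∫ ω, ‖X ω‖ ^ 2 ∂P + v * ∫ ω, ∑ m, ‖V ω m‖ ^ 2 ∂P := by
  have hVm : AEMeasurable V P := aemeasurable_pi_lambda _ fun m => (hV m).1.aemeasurable
  have hW : AEMeasurable (fun ω => (X ω, V ω)) P := hX.1.aemeasurable.prodMk hVm
  have hint1 : ∀ {f : (Fin M → ℂ) → ℂ} {g : ℂ × (Fin M → ℂ) → ℂ}, Measurable f → Measurable g →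
      ∫ ω, f (R ω) * g (X ω, V ω) ∂P = (∫ ω, f (R ω) ∂P) * ∫ ω, g (X ω, V ω) ∂P := by
    intro f g hf hg
    exact hind.integral_fun_comp_mul_comp hR.aemeasurable hW hf.aestronglyMeasurable
      hg.aestronglyMeasurable
  have hint2 : ∀ {f : (Fin M → ℂ) → ℂ} {g : ℂ × (Fin M → ℂ) → ℂ}, Measurable f → Measurable g →
      Integrable (fun ω => f (R ω)) P → Integrable (fun ω => g (X ω, V ω)) P →
      Integrable (fun ω => f (R ω) * g (X ω, V ω)) P := by
    intro f g hf hg h1 h2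
    exact (hind.comp hf hg).integrable_mul h1 h2
  have hstar : Measurable (starRingEnd ℂ) := Complex.continuous_conj.measurable
  have me : ∀ m, Measurable (fun z : Fin M → ℂ => z m) := fun m => measurable_pi_apply m
  have mV : ∀ m, Measurable (fun z : ℂ × (Fin M → ℂ) => z.2 m) := fun m => by fun_prop
  have hconj : ∀ {f : Ω → ℂ}, MemLp f 2 P → MemLp (fun ω => (starRingEnd ℂ) (f ω)) 2 P :=
    fun hf => hf.star
  -- A product of two square integrable functions is in general only integrable; here independence
  -- of the squared factors gives `L²`.
  have hRV : ∀ m, MemLp (fun ω => R ω m * V ω m) 2 P := by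
    intro m
    have hm : AEStronglyMeasurable (fun ω => R ω m * V ω m) P := (hR.memLp m).1.mul (hV m).1
    rw [memLp_two_iff_integrable_sq_norm hm]
    have h1 := (memLp_two_iff_integrable_sq_norm (hR.memLp m).1).1 (hR.memLp m)
    have h2 := (memLp_two_iff_integrable_sq_norm (hV m).1).1 (hV m)
    have := (hind.comp (φ := fun z : Fin M → ℂ => ‖z m‖ ^ 2)
      (ψ := fun z : ℂ × (Fin M → ℂ) => ‖z.2 m‖ ^ 2)
      (by fun_prop) (by fun_prop)).integrable_mul h1 h2
    refine this.congr (.of_forall fun ω => ?_)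
    simp [mul_pow]
  have hdot : MemLp (fun ω => R ω ⬝ᵥ V ω) 2 P := by
    unfold dotProduct
    exact memLp_finsetSum _ fun m _ => hRV m
  have hmem : MemLp (fun ω => X ω + R ω ⬝ᵥ V ω) 2 P := hX.add hdot
  have hRint : ∀ m, Integrable (fun ω => R ω m) P := fun m => (hR.memLp m).integrable (by simp)
  refine ⟨hmem, ?_, ?_⟩
  · rw [integral_add (hX.integrable (by simp)) (hdot.integrable (by simp))]
    unfold dotProduct
    rw [integral_finsetSum _ fun m _ => (hRV m).integrable (by simp)]
    have : ∀ m, ∫ ω, R ω m * V ω m ∂P = 0 := by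
      intro m
      rw [hint1 (me m) (mV m), hR.integral_eq_zero, zero_mul]
    simp [this]
  · have hc : ∀ z : ℂ, ((‖z‖ ^ 2 : ℝ) : ℂ) = z * (starRingEnd ℂ) z := fun z => by
      rw [Complex.mul_conj']; simp
    have hcross : ∫ ω, (R ω ⬝ᵥ V ω) * (starRingEnd ℂ) (X ω) ∂P = 0 := by
      unfold dotProduct
      simp_rw [Finset.sum_mul]
      rw [integral_finsetSum]
      · refine Finset.sum_eq_zero fun m _ => ?_
        simp_rw [mul_assoc]
        rw [hint1 (g := fun w => w.2 m * (starRingEnd ℂ) w.1) (me m)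
          ((mV m).mul (hstar.comp measurable_fst)), hR.integral_eq_zero, zero_mul]
      · intro m _
        exact (hRV m).integrable_mul (hconj hX)
    have hcross' : ∫ ω, X ω * (starRingEnd ℂ) (R ω ⬝ᵥ V ω) ∂P = 0 := by
      rw [← map_zero (starRingEnd ℂ), ← hcross, ← integral_conj]
      congr 1
      ext ω
      simp [mul_comm]
    have hquad : ∫ ω, (R ω ⬝ᵥ V ω) * (starRingEnd ℂ) (R ω ⬝ᵥ V ω) ∂P =
        v * ∫ ω, ∑ m, V ω m * (starRingEnd ℂ) (V ω m) ∂P := by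
      have hVV : ∀ m, Integrable (fun ω => V ω m * (starRingEnd ℂ) (V ω m)) P := fun m =>
        (hV m).integrable_mul (hconj (hV m))
      have e : ∀ ω, (R ω ⬝ᵥ V ω) * (starRingEnd ℂ) (R ω ⬝ᵥ V ω) =
          ∑ m, ∑ m', (R ω m * (starRingEnd ℂ) (R ω m')) *
            (V ω m * (starRingEnd ℂ) (V ω m')) := by
        intro ω
        simp only [dotProduct, map_sum, map_mul, Finset.sum_mul_sum]
        refine Finset.sum_congr rfl fun m _ => Finset.sum_congr rfl fun m' _ => ?_
        ring
      have hi : ∀ m m', Integrable (fun ω => (R ω m * (starRingEnd ℂ) (R ω m')) *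
            (V ω m * (starRingEnd ℂ) (V ω m'))) P := fun m m' =>
        hint2 (f := fun z => z m * (starRingEnd ℂ) (z m'))
          (g := fun w => w.2 m * (starRingEnd ℂ) (w.2 m'))
          ((me m).mul (hstar.comp (me m'))) ((mV m).mul (hstar.comp (mV m')))
          ((hR.memLp m).integrable_mul (hconj (hR.memLp m')))
          ((hV m).integrable_mul (hconj (hV m')))
      simp_rw [e]
      rw [integral_finsetSum _ fun m _ => integrable_finsetSum _ fun m' _ => hi m m',
        integral_finsetSum _ fun m _ => hVV m, Finset.mul_sum]
      refine Finset.sum_congr rfl fun m _ => ?_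
      rw [integral_finsetSum _ fun m' _ => hi m m']
      have e2 : ∀ m', ∫ ω, (R ω m * (starRingEnd ℂ) (R ω m')) *
            (V ω m * (starRingEnd ℂ) (V ω m')) ∂P =
            if m = m' then v * ∫ ω, V ω m * (starRingEnd ℂ) (V ω m) ∂P else 0 := by
        intro m'
        rw [hint1 (f := fun z => z m * (starRingEnd ℂ) (z m'))
          (g := fun w => w.2 m * (starRingEnd ℂ) (w.2 m'))
          ((me m).mul (hstar.comp (me m'))) ((mV m).mul (hstar.comp (mV m'))),
          hR.integral_mul_conj]
        split_ifs with h
        · subst h; rfl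
        · simp
      simp_rw [e2]
      simp
    -- Over `ℂ` the square `‖z‖²` is `z * conj z`, so the second moment expands into four terms; the
    -- cross terms vanish and `hquad` evaluates the last one.
    apply Complex.ofReal_injective
    push_cast
    rw [← integral_complex_ofReal, ← integral_complex_ofReal, ← integral_complex_ofReal]
    simp_rw [Complex.ofReal_sum, hc]
    rw [← hquad]
    have i1 := hX.integrable_mul (hconj hX)
    have i2 := hX.integrable_mul (hconj hdot)
    have i3 := hdot.integrable_mul (hconj hX)
    have i4 := hdot.integrable_mul (hconj hdot)
    have e : ∀ ω, (X ω + R ω ⬝ᵥ V ω) * (starRingEnd ℂ) (X ω + R ω ⬝ᵥ V ω) =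
        (X ω * (starRingEnd ℂ) (X ω) + X ω * (starRingEnd ℂ) (R ω ⬝ᵥ V ω)) +
        ((R ω ⬝ᵥ V ω) * (starRingEnd ℂ) (X ω) +
          (R ω ⬝ᵥ V ω) * (starRingEnd ℂ) (R ω ⬝ᵥ V ω)) := by
      intro ω
      rw [map_add]
      ring
    simp_rw [e]
    rw [integral_add, integral_add, integral_add, hcross, hcross']
    · simp
    · exact i3
    · exact i4
    · exact i1
    · exact i2
    · exact i1.add i2
    · exact i3.add i4

end

/-! ### Independence by disjoint sets of sources -/

lemma measurable_smul_add_smul {Ω : Type*} {m : MeasurableSpace Ω} {M : ℕ} (a b : ℝ)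
    {x y : Ω → Fin M → ℂ} (hx : Measurable x) (hy : Measurable y) :
    Measurable (a • x + b • y) :=
  ((measurable_smulVec a).comp hx).add ((measurable_smulVec b).comp hy)

/-- The `σ`-algebra generated by the sources with index in `S`. -/
@[reducible]
def sourceAlgebra {Ω ι F : Type*} [MeasurableSpace F] (ξ : ι → Ω → F) (S : Set ι) :
    MeasurableSpace Ω :=
  ⨆ x ∈ S, MeasurableSpace.comap (ξ x) inferInstance

section SourceAlgebra

variable {Ω ι F : Type*} [MeasurableSpace F] {ξ : ι → Ω → F}

lemma sourceAlgebra_mono {S T : Set ι} (h : S ⊆ T) : sourceAlgebra ξ S ≤ sourceAlgebra ξ T :=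
  biSup_mono h

lemma measurable_source {S : Set ι} {x : ι} (hx : x ∈ S) :
    Measurable[sourceAlgebra ξ S] (ξ x) :=
  measurable_iff_comap_le.2 (le_iSup₂ (f := fun x (_ : x ∈ S) =>
    MeasurableSpace.comap (ξ x) inferInstance) x hx)

lemma indepFun_of_measurable_sourceAlgebra [MeasurableSpace Ω] {P : Measure Ω}
    (hm : ∀ x, Measurable (ξ x)) (hξ : iIndepFun ξ P) {S T : Set ι} (hST : Disjoint S T)
    {α β : Type*} [MeasurableSpace α] [MeasurableSpace β] {f : Ω → α} {g : Ω → β}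
    (hf : Measurable[sourceAlgebra ξ S] f) (hg : Measurable[sourceAlgebra ξ T] g) :
    IndepFun f g P := by
  rw [IndepFun_iff_Indep]
  exact indep_of_indep_of_le (indep_iSup_of_disjoint (fun x => (hm x).comap_le) hξ.iIndep hST)
    hf.comap_le hg.comap_le

end SourceAlgebra

/-! ### The unrolled Gauss-Markov recursion -/

section Recursion

variable {Ω : Type*} {M K : ℕ}

/-- The Gauss-Markov channel driven by given sources. -/
noncomputable def channelOf (ρ : Fin K → ℝ) (ξ : Fin K ⊕ Fin K × ℕ → Ω → Fin M → ℂ) (k : Fin K) :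
    ℕ → Ω → Fin M → ℂ
  | 0 => ξ (Sum.inl k)
  | i + 1 => ρ k • channelOf ρ ξ k i + √(1 - ρ k ^ 2) • ξ (Sum.inr (k, i))

/-- The part of `channelOf` in block `i + n` which was not present in block `i`. -/
noncomputable def residualOf (ρ : Fin K → ℝ) (ξ : Fin K ⊕ Fin K × ℕ → Ω → Fin M → ℂ) (k : Fin K)
    (i : ℕ) : ℕ → Ω → Fin M → ℂ
  | 0 => 0
  | n + 1 => ρ k • residualOf ρ ξ k i n + √(1 - ρ k ^ 2) • ξ (Sum.inr (k, i + n))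

variable {ρ : Fin K → ℝ} {ξ : Fin K ⊕ Fin K × ℕ → Ω → Fin M → ℂ}

lemma channelOf_add (k : Fin K) (i n : ℕ) :
    channelOf ρ ξ k (i + n) = ρ k ^ n • channelOf ρ ξ k i + residualOf ρ ξ k i n := by
  induction n with
  | zero => simp [residualOf]
  | succ n ih =>
    rw [← add_assoc, channelOf, ih, residualOf, smul_add, smul_smul, ← pow_succ', add_assoc]

/-- The sources which determine the channel of user `k` in block `i`. -/
def pastSources (k : Fin K) (i : ℕ) : Set (Fin K ⊕ Fin K × ℕ) :=
  {x | x = Sum.inl k ∨ ∃ j < i, x = Sum.inr (k, j)}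

/-- The innovations of user `k` in the blocks `i, …, i + n - 1`. -/
def recentSources (k : Fin K) (i n : ℕ) : Set (Fin K ⊕ Fin K × ℕ) :=
  {x | ∃ j, i ≤ j ∧ j < i + n ∧ x = Sum.inr (k, j)}

lemma measurable_channelOf (k : Fin K) (i : ℕ) :
    Measurable[sourceAlgebra ξ (pastSources k i)] (channelOf ρ ξ k i) := by
  induction i with
  | zero => exact measurable_source (Or.inl rfl)
  | succ i ih =>
    refine measurable_smul_add_smul _ _ (ih.mono (sourceAlgebra_mono ?_) le_rfl)
      (measurable_source (Or.inr ⟨i, i.lt_succ_self, rfl⟩))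
    rintro x (hx | ⟨j, hj, hx⟩)
    · exact Or.inl hx
    · exact Or.inr ⟨j, hj.trans i.lt_succ_self, hx⟩

lemma measurable_residualOf (k : Fin K) (i n : ℕ) :
    Measurable[sourceAlgebra ξ (recentSources k i n)] (residualOf ρ ξ k i n) := by
  induction n with
  | zero => exact @measurable_const _ _ _ (sourceAlgebra ξ (recentSources k i 0)) 0
  | succ n ih =>
    refine measurable_smul_add_smul _ _ (ih.mono (sourceAlgebra_mono ?_) le_rfl)
      (measurable_source ⟨i + n, by omega, by omega, rfl⟩)
    rintro x ⟨j, h1, h2, hx⟩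
    exact ⟨j, h1, by omega, hx⟩

variable [MeasurableSpace Ω] {P : Measure Ω}

lemma indepFun_channelOf_others (hm : ∀ x, Measurable (ξ x)) (hξ : iIndepFun ξ P)
    (s : Fin K → ℕ) (i : Fin K) :
    IndepFun (channelOf ρ ξ i (s i))
      (fun ω (j : {j : Fin K // j ≠ i}) => channelOf ρ ξ j (s j) ω) P := by
  refine indepFun_of_measurable_sourceAlgebra hm hξ (T := ⋃ j ≠ i, pastSources j (s j)) ?_
    (measurable_channelOf i (s i)) ?_
  · rw [Set.disjoint_left]
    rintro x hx hx'
    simp only [Set.mem_iUnion] at hx'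
    obtain ⟨j, hj, hx'⟩ := hx'
    rcases hx with rfl | ⟨a, _, rfl⟩ <;> rcases hx' with hx' | ⟨b, _, hx'⟩ <;> simp_all
  · refine @measurable_pi_lambda _ _ _ (_) _ _ fun j => ?_
    exact (measurable_channelOf _ _).mono (sourceAlgebra_mono
      (Set.subset_biUnion_of_mem (u := fun j => pastSources j (s j)) j.2)) le_rfl

/-- The residual uses innovations of user `k` from block `s k` on, while the columns use those of
user `k` before `s k` and sources of other users. Independence from the whole family is needed,
since a zero-forcing direction involves every column. -/
lemma indepFun_residualOf_channelOf (hm : ∀ x, Measurable (ξ x)) (hξ : iIndepFun ξ P)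
    (s : Fin K → ℕ) (k : Fin K) (n : ℕ) :
    IndepFun (residualOf ρ ξ k (s k) n) (fun ω j => channelOf ρ ξ j (s j) ω) P := by
  refine indepFun_of_measurable_sourceAlgebra hm hξ (T := ⋃ j, pastSources j (s j)) ?_
    (measurable_residualOf k (s k) n) ?_
  · rw [Set.disjoint_left]
    rintro x ⟨a, h1, h2, rfl⟩ hx'
    simp only [Set.mem_iUnion] at hx'
    obtain ⟨j, hx' | ⟨b, hb, hx'⟩⟩ := hx'
    · cases hx'
    · simp only [Sum.inr.injEq, Prod.mk.injEq] at hx'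
      obtain ⟨rfl, rfl⟩ := hx'
      omega
  · refine @measurable_pi_lambda _ _ _ (_) _ _ fun j => ?_
    exact (measurable_channelOf _ _).mono (sourceAlgebra_mono
      (Set.subset_iUnion (fun j => pastSources j (s j)) j)) le_rfl

variable [IsProbabilityMeasure P]

lemma hasLaw_channelOf (hm : ∀ x, Measurable (ξ x)) (hξ : iIndepFun ξ P)
    (hlaw : ∀ x, HasLaw (ξ x) (complexGaussianVec M) P) (hρ : ∀ i, |ρ i| ≤ 1)
    (k : Fin K) (i : ℕ) : HasLaw (channelOf ρ ξ k i) (scaledGaussianVec M 1) P := by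
  induction i with
  | zero => rw [scaledGaussianVec_one]; exact hlaw _
  | succ i ih =>
    have hs : (√(1 - ρ k ^ 2)) ^ 2 = 1 - ρ k ^ 2 :=
      Real.sq_sqrt (by have := (sq_le_one_iff_abs_le_one _).2 (hρ k); linarith)
    have h2 : HasLaw (ξ (Sum.inr (k, i))) (scaledGaussianVec M 1) P := by
      rw [scaledGaussianVec_one]; exact hlaw _
    refine hasLaw_add_of_indepFun (hasLaw_smul ih (c := ρ k) (by ring))
      (hasLaw_smul h2 (c := √(1 - ρ k ^ 2)) (by ring)) ?_ (by rw [hs]; ring)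
    have : IndepFun (channelOf ρ ξ k i) (ξ (Sum.inr (k, i))) P := by
      refine indepFun_of_measurable_sourceAlgebra hm hξ (T := {Sum.inr (k, i)}) ?_
        (measurable_channelOf k i) (measurable_source rfl)
      rw [Set.disjoint_singleton_right]
      rintro (hx | ⟨j, hj, hx⟩)
      · cases hx
      · simp only [Sum.inr.injEq, Prod.mk.injEq, true_and] at hx
        omega
    exact this.comp (measurable_smulVec _) (measurable_smulVec _)

lemma hasLaw_residualOf (hm : ∀ x, Measurable (ξ x)) (hξ : iIndepFun ξ P)
    (hlaw : ∀ x, HasLaw (ξ x) (complexGaussianVec M) P) (hρ : ∀ i, |ρ i| ≤ 1)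
    (k : Fin K) (i n : ℕ) :
    HasLaw (residualOf ρ ξ k i n) (scaledGaussianVec M √(1 - ρ k ^ (2 * n))) P := by
  induction n with
  | zero =>
    -- At age zero the scale is `0` and the law is the Dirac mass at the origin.
    refine ⟨aemeasurable_const, ?_⟩
    simp [residualOf, scaledGaussianVec, Pi.zero_def]
  | succ n ih =>
    have hsq : ρ k ^ 2 ≤ 1 := (sq_le_one_iff_abs_le_one _).2 (hρ k)
    have hs : (√(1 - ρ k ^ 2)) ^ 2 = 1 - ρ k ^ 2 := Real.sq_sqrt (by linarith)
    have hs' : ∀ n, (√(1 - ρ k ^ (2 * n))) ^ 2 = 1 - ρ k ^ (2 * n) := fun n =>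
      Real.sq_sqrt (by rw [pow_mul]; linarith [pow_le_one₀ (n := n) (sq_nonneg (ρ k)) hsq])
    have h2 : HasLaw (ξ (Sum.inr (k, i + n))) (scaledGaussianVec M 1) P := by
      rw [scaledGaussianVec_one]; exact hlaw _
    refine hasLaw_add_of_indepFun (hasLaw_smul ih (c := ρ k * √(1 - ρ k ^ (2 * n))) rfl)
      (hasLaw_smul h2 (c := √(1 - ρ k ^ 2)) (by ring)) ?_
      -- The variances satisfy `ρ² (1 - ρ ^ (2n)) + (1 - ρ²) = 1 - ρ ^ (2n + 2)`.
      (by rw [mul_pow, hs, hs', hs']; ring)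
    have : IndepFun (residualOf ρ ξ k i n) (ξ (Sum.inr (k, i + n))) P := by
      refine indepFun_of_measurable_sourceAlgebra hm hξ (T := {Sum.inr (k, i + n)}) ?_
        (measurable_residualOf k i n) (measurable_source rfl)
      rw [Set.disjoint_singleton_right]
      rintro ⟨j, h1, h2, hx⟩
      simp only [Sum.inr.injEq, Prod.mk.injEq, true_and] at hx
      omega
    exact this.comp (measurable_smulVec _) (measurable_smulVec _)

end Recursion

/-- A joint version of the channel with measurable sources. -/
lemma IsGaussMarkovChannel.exists_sources {Ω : Type*} [MeasurableSpace Ω] {P : Measure Ω}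
    {M K : ℕ} {ρ : Fin K → ℝ} {h e : Fin K → ℕ → Ω → Fin M → ℂ}
    (hch : IsGaussMarkovChannel P ρ h e) :
    ∃ ξ : Fin K ⊕ Fin K × ℕ → Ω → Fin M → ℂ, (∀ x, Measurable (ξ x)) ∧ iIndepFun ξ P ∧
      (∀ x, HasLaw (ξ x) (complexGaussianVec M) P) ∧
      ∀ k i, h k i =ᵐ[P] channelOf ρ ξ k i := by
  set ζ : Fin K ⊕ Fin K × ℕ → Ω → Fin M → ℂ :=
    Sum.elim (fun k => h k 0) (fun p => e p.1 p.2) with hζ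
  have hlaw : ∀ x, HasLaw (ζ x) (complexGaussianVec M) P := by
    rintro (k | p)
    · exact hch.law_init k
    · exact hch.law_innovation p.1 p.2
  -- The given sources are only almost everywhere measurable, but the source algebras need
  -- measurable maps, so each source is replaced by a measurable modification.
  have hae := fun x => (hlaw x).aemeasurable.ae_eq_mk
  refine ⟨fun x => (hlaw x).aemeasurable.mk, fun x => (hlaw x).aemeasurable.measurable_mk,
    (iIndepFun_congr hae).1 hch.indep, fun x => (hlaw x).congr (hae x).symm, fun k i => ?_⟩
  induction i with
  | zero => exact hae (Sum.inl k)
  | succ i ih =>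
    filter_upwards [ih, hch.evolution k i, hae (Sum.inr (k, i))] with ω h1 h2 h3
    ext m
    rw [h2 m, h1]
    have h3' : e k i ω = _ := h3
    rw [h3']
    simp [channelOf]

section Channel

variable {Ω : Type*} [MeasurableSpace Ω] {P : Measure Ω} {M K : ℕ}
  {ρ : Fin K → ℝ} {h e : Fin K → ℕ → Ω → Fin M → ℂ}

lemma IsGaussMarkovChannel.hasLaw [IsProbabilityMeasure P]
    (hch : IsGaussMarkovChannel P ρ h e) (hρ : ∀ i, |ρ i| ≤ 1)
    (k : Fin K) (i : ℕ) : HasLaw (h k i) (complexGaussianVec M) P := by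
  obtain ⟨ξ, hm, hξ, hlaw, heq⟩ := hch.exists_sources
  rw [← scaledGaussianVec_one]
  exact (hasLaw_channelOf hm hξ hlaw hρ k i).congr (heq k i)

lemma IsGaussMarkovChannel.indepFun_others (hch : IsGaussMarkovChannel P ρ h e)
    (s : Fin K → ℕ) (i : Fin K) :
    IndepFun (h i (s i)) (fun ω (j : {j : Fin K // j ≠ i}) => h j (s j) ω) P := by
  obtain ⟨ξ, hm, hξ, hlaw, heq⟩ := hch.exists_sources
  refine (indepFun_channelOf_others (ρ := ρ) hm hξ s i).congr (heq i (s i)).symm ?_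
  have : ∀ᵐ ω ∂P, ∀ j, h j (s j) ω = channelOf ρ ξ j (s j) ω := ae_all_iff.2 fun j => heq j _
  filter_upwards [this] with ω hω
  ext1 j
  exact (hω j).symm

lemma IsGaussMarkovChannel.exists_residual [IsProbabilityMeasure P]
    (hch : IsGaussMarkovChannel P ρ h e)
    (hρ : ∀ i, |ρ i| ≤ 1) (s : Fin K → ℕ) (k : Fin K) (n : ℕ) :
    ∃ R : Ω → Fin M → ℂ, HasLaw R (scaledGaussianVec M √(1 - ρ k ^ (2 * n))) P ∧
      IndepFun R (fun ω j => h j (s j) ω) P ∧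
      ∀ᵐ ω ∂P, h k (s k + n) ω = (ρ k ^ n) • h k (s k) ω + R ω := by
  obtain ⟨ξ, hm, hξ, hlaw, heq⟩ := hch.exists_sources
  refine ⟨residualOf ρ ξ k (s k) n, hasLaw_residualOf hm hξ hlaw hρ k (s k) n, ?_, ?_⟩
  · refine (indepFun_residualOf_channelOf (ρ := ρ) hm hξ s k n).congr (by rfl) ?_
    have : ∀ᵐ ω ∂P, ∀ j, h j (s j) ω = channelOf ρ ξ j (s j) ω := ae_all_iff.2 fun j => heq j _
    filter_upwards [this] with ω hω
    ext1 j
    exact (hω j).symm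
  · filter_upwards [heq k (s k), heq k (s k + n)] with ω h1 h2
    rw [h1, h2, channelOf_add]
    rfl

end Channel

/-- The matrix with given columns. -/
def ofColumns {M K : ℕ} (x : Fin K → Fin M → ℂ) : Matrix (Fin M) (Fin K) ℂ :=
  Matrix.of fun m i => x i m

/-- The component of `z` orthogonal to the span of the vectors `y j`. -/
noncomputable def orthComponent {M : ℕ} {ι : Type*} (y : ι → Fin M → ℂ) (z : Fin M → ℂ) :
    EuclideanSpace ℂ (Fin M) :=
  (Submodule.span ℂ (Set.range fun j => WithLp.toLp 2 (y j)))ᗮ.orthogonalProjectionOnto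
    (WithLp.toLp 2 z)

/-! ### Gram matrices and zero-forcing directions -/

section Algebra

variable {M K : ℕ}

lemma gram_ofColumns_apply (x : Fin K → Fin M → ℂ) (i j : Fin K) :
    gram (ofColumns x) i j = inner ℂ (WithLp.toLp 2 (x j)) (WithLp.toLp 2 (x i)) := by
  simp [gram, Matrix.mul_apply, conjMat, ofColumns, PiLp.inner_apply]

open scoped ComplexOrder in
lemma isUnit_det_gram {x : Fin K → Fin M → ℂ}
    (hx : LinearIndependent ℂ fun i => WithLp.toLp 2 (x i)) :
    IsUnit (gram (ofColumns x)).det := by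
  have h : gram (ofColumns x) = (Matrix.gram ℂ fun i => WithLp.toLp 2 (x i))ᵀ := by
    ext i j
    rw [gram_ofColumns_apply, Matrix.transpose_apply, Matrix.gram_apply]
  rw [h, Matrix.det_transpose]
  exact (Matrix.posDef_gram_of_linearIndependent hx).det_pos.ne'.isUnit

/-- The orthogonal component `q` of column `i` is a combination `∑ w_j x_j` with `w_i = 1`. Pairing
it with the columns gives `G conj(w) = ‖q‖² e_i`; applying `G⁻¹` and reading entry `i` gives `1 =
(G⁻¹)_{ii} ‖q‖²`. -/
lemma inv_gram_apply_self {x : Fin K → Fin M → ℂ} (hx : IsUnit (gram (ofColumns x)).det)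
    (i : Fin K) :
    (gram (ofColumns x))⁻¹ i i =
      (((‖orthComponent (fun j : {j : Fin K // j ≠ i} => x j) (x i)‖ ^ 2)⁻¹ : ℝ) : ℂ) := by
  set a : Fin K → EuclideanSpace ℂ (Fin M) := fun j => WithLp.toLp 2 (x j) with ha
  set W := Submodule.span ℂ (Set.range fun j : {j : Fin K // j ≠ i} => a j) with hW
  set q := orthComponent (fun j : {j : Fin K // j ≠ i} => x j) (x i) with hq
  have hqW : q ∈ Wᗮ := Submodule.coe_mem _
  have hsub : a i - q ∈ W := by
    have : a i - q = W.starProjection (a i) := by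
      rw [sub_eq_iff_eq_add]
      exact (W.starProjection_add_starProjection_orthogonal (a i)).symm
    rw [this]
    exact Submodule.starProjection_apply_mem _ _
  obtain ⟨c, hc⟩ := (Submodule.mem_span_range_iff_exists_fun ℂ).1 hsub
  let w : Fin K → ℂ := fun j => if hj : j ≠ i then -c ⟨j, hj⟩ else 1
  have hwi : w i = 1 := by simp [w]
  have hw : ∑ j, w j • a j = q := by
    rw [Fintype.sum_eq_add_sum_subtype_ne _ i, hwi]
    have : ∀ j : {j : Fin K // j ≠ i}, w j • a j = -(c j • a j) := fun j => by
      simp [w, j.2]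
    simp_rw [this]
    rw [Finset.sum_neg_distrib, hc]
    simp
  have horth : ∀ l, inner ℂ q (a l) = if l = i then ((‖q‖ ^ 2 : ℝ) : ℂ) else 0 := by
    intro l
    split_ifs with hl
    · subst hl
      have : a l = (a l - q) + q := by abel
      rw [this, inner_add_right, Submodule.inner_left_of_mem_orthogonal hsub hqW,
        inner_self_eq_norm_sq_to_K]
      simp
    · exact Submodule.inner_left_of_mem_orthogonal 
        (Submodule.subset_span (Set.mem_range_self (⟨l, hl⟩ : {j : Fin K // j ≠ i}))) hqW
  have hG : gram (ofColumns x) *ᵥ (fun j => (starRingEnd ℂ) (w j)) =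
      Pi.single i ((‖q‖ ^ 2 : ℝ) : ℂ) := by
    ext l
    rw [Pi.single_apply, ← horth l, ← hw, sum_inner]
    simp only [Matrix.mulVec, dotProduct, gram_ofColumns_apply, inner_smul_left]
    exact Finset.sum_congr rfl fun j _ => mul_comm _ _
  have h1 : (1 : ℂ) = (gram (ofColumns x))⁻¹ i i * ((‖q‖ ^ 2 : ℝ) : ℂ) := by
    have := congrArg (fun v => ((gram (ofColumns x))⁻¹ *ᵥ v) i) hG
    simp only [Matrix.mulVec_mulVec, Matrix.nonsing_inv_mul _ hx, Matrix.one_mulVec, hwi,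
      map_one, Matrix.mulVec_single] at this
    simpa using this
  rw [Complex.ofReal_inv]
  exact eq_inv_of_mul_eq_one_left h1.symm

lemma linearIndependent_of_orthComponent_ne_zero {x : Fin K → Fin M → ℂ}
    (hx : ∀ i, orthComponent (fun j : {j : Fin K // j ≠ i} => x j) (x i) ≠ 0) :
    LinearIndependent ℂ fun i => (WithLp.toLp 2 (x i) : EuclideanSpace ℂ (Fin M)) := by
  rw [linearIndependent_iff_notMem_span]
  intro i hi
  refine hx i ?_
  have himg : (fun i => (WithLp.toLp 2 (x i) : EuclideanSpace ℂ (Fin M))) '' (Set.univ \ {i}) =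
      Set.range fun j : {j : Fin K // j ≠ i} => WithLp.toLp 2 (x j) := by
    ext v
    simp
  rw [himg] at hi
  rw [orthComponent, Submodule.orthogonalProjectionOnto_orthogonal_apply_eq_zero hi]
  rfl

/-- The zero-forcing directions are dual to the columns. -/
lemma dotProduct_zf {x : Fin K → Fin M → ℂ} (hx : IsUnit (gram (ofColumns x)).det)
    (k i : Fin K) :
    (x k ⬝ᵥ fun m => (conjMat (ofColumns x) * (gram (ofColumns x))⁻¹) m i) =
      if k = i then 1 else 0 := by
  have : (ofColumns x)ᵀ * (conjMat (ofColumns x) * (gram (ofColumns x))⁻¹) = 1 := by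
    rw [← Matrix.mul_assoc]
    exact Matrix.mul_nonsing_inv _ hx
  have := congrFun (congrFun this k) i
  rwa [Matrix.one_apply] at this

/-- For `V = A^* G⁻¹` with `G` Hermitian, `Vᴴ V = G⁻¹ G G⁻¹ = G⁻¹`. -/
lemma sum_normSq_zf {x : Fin K → Fin M → ℂ} (hx : IsUnit (gram (ofColumns x)).det)
    (i : Fin K) :
    ((∑ m, ‖(conjMat (ofColumns x) * (gram (ofColumns x))⁻¹) m i‖ ^ 2 : ℝ) : ℂ) =
      (gram (ofColumns x))⁻¹ i i := by
  set A := ofColumns x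
  set G := gram A with hG
  set V := conjMat A * G⁻¹ with hV
  have hA : conjMat A = Aᴴᵀ := by ext; simp [conjMat]
  have hGh : Gᴴ = G := by
    rw [hG, gram, hA, Matrix.conjTranspose_mul]
    congr 1
    · ext; simp
  have h1 : Vᴴ * V = G⁻¹ := by
    rw [hV, Matrix.conjTranspose_mul, Matrix.conjTranspose_nonsing_inv, hGh]
    have : (conjMat A)ᴴ = Aᵀ := by ext; simp [conjMat]
    rw [this, Matrix.mul_assoc, ← Matrix.mul_assoc Aᵀ]
    change G⁻¹ * (G * G⁻¹) = _
    rw [Matrix.mul_nonsing_inv _ hx, Matrix.mul_one]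
  rw [← h1, Matrix.mul_apply]
  push_cast
  refine Finset.sum_congr rfl fun m _ => ?_
  rw [Matrix.conjTranspose_apply, ← starRingEnd_apply, Complex.conj_mul']

lemma measurable_inv_gram (i j : Fin K) :
    Measurable fun x : Fin K → Fin M → ℂ => (gram (ofColumns x))⁻¹ i j := by
  have hc : Continuous fun x : Fin K → Fin M → ℂ => gram (ofColumns x) := by
    refine continuous_matrix fun i j => ?_
    simp only [gram, Matrix.mul_apply, conjMat, ofColumns, Matrix.transpose_apply,
      Matrix.of_apply, Matrix.map_apply]
    fun_prop
  simp_rw [Matrix.inv_def, Ring.inverse_eq_inv', Matrix.smul_apply, smul_eq_mul]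
  exact hc.matrix_det.measurable.inv.mul (hc.matrix_adjugate.matrix_elem i j).measurable

lemma measurable_zf (m : Fin M) (i : Fin K) :
    Measurable fun x : Fin K → Fin M → ℂ =>
      (conjMat (ofColumns x) * (gram (ofColumns x))⁻¹) m i := by
  simp_rw [Matrix.mul_apply]
  refine Finset.measurable_sum _ fun j _ => Measurable.mul ?_ (measurable_inv_gram j i)
  have : Continuous fun x : Fin K → Fin M → ℂ => conjMat (ofColumns x) m j := by
    simp only [conjMat, ofColumns, Matrix.of_apply, Matrix.map_apply]
    fun_prop
  exact this.measurable

end Algebra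

/-! ### Distance to a random span -/

section Distance

variable {M : ℕ} {ι : Type*} [Fintype ι]

/-- This gives joint measurability in `y` and `z`, although the subspace varies with `y`: the
distance is a countable infimum of functions continuous in both. -/
lemma enorm_orthComponent_eq_iInf (y : ι → Fin M → ℂ) (z : Fin M → ℂ) :
    ‖orthComponent y z‖ₑ = ⨅ n, ‖(WithLp.toLp 2 z : EuclideanSpace ℂ (Fin M)) -
      ∑ j, TopologicalSpace.denseSeq (ι → ℂ) n j • WithLp.toLp 2 (y j)‖ₑ := by
  set W := Submodule.span ℂ (Set.range fun j => (WithLp.toLp 2 (y j) : EuclideanSpace ℂ (Fin M)))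
    with hW
  set f : (ι → ℂ) → ENNReal := fun c =>
    ‖(WithLp.toLp 2 z : EuclideanSpace ℂ (Fin M)) - ∑ j, c j • WithLp.toLp 2 (y j)‖ₑ with hf
  have hfc : Continuous f := by fun_prop
  refine le_antisymm (le_iInf fun n => ?_) ?_
  · set u := ∑ j, TopologicalSpace.denseSeq (ι → ℂ) n j •
      (WithLp.toLp 2 (y j) : EuclideanSpace ℂ (Fin M)) with hu
    have huW : u ∈ W := Submodule.sum_mem _ fun j _ =>
      Submodule.smul_mem _ _ (Submodule.subset_span ⟨j, rfl⟩)
    have h1 : orthComponent y z = Wᗮ.orthogonalProjectionOnto (WithLp.toLp 2 z - u) := by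
      rw [map_sub, Submodule.orthogonalProjectionOnto_orthogonal_apply_eq_zero huW, sub_zero]
      rfl
    rw [h1, ← ofReal_norm, ← ofReal_norm]
    exact ENNReal.ofReal_le_ofReal 
      (Wᗮ.norm_orthogonalProjectionOnto_apply_le (WithLp.toLp 2 z - u))
  · have hle : ∀ c, ⨅ n, f (TopologicalSpace.denseSeq (ι → ℂ) n) ≤ f c := fun c =>
      (TopologicalSpace.denseRange_denseSeq (ι → ℂ)).induction_on c
        (isClosed_le continuous_const hfc) fun n => iInf_le _ n
    obtain ⟨c, hc⟩ := (Submodule.mem_span_range_iff_exists_fun ℂ).1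
      (Submodule.starProjection_apply_mem W (WithLp.toLp 2 z))
    refine (hle c).trans_eq ?_
    rw [hf]
    simp only
    rw [hc]
    congr 1
    rw [sub_eq_iff_eq_add, add_comm]
    exact (W.starProjection_add_starProjection_orthogonal _).symm

lemma measurable_enorm_orthComponent :
    Measurable fun p : (Fin M → ℂ) × (ι → Fin M → ℂ) => ‖orthComponent p.2 p.1‖ₑ := by
  simp_rw [enorm_orthComponent_eq_iInf]
  refine Measurable.iInf fun n => Continuous.measurable ?_
  fun_prop

/-- The rank is left open because arbitrary `y` may be dependent; it never exceeds the number of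
vectors, so the complement keeps dimension at least two. -/
lemma lintegral_inv_enorm_orthComponent_sq (y : ι → Fin M → ℂ)
    (hι : Fintype.card ι + 2 ≤ M) :
    ∫⁻ z, (‖orthComponent y z‖ₑ ^ 2)⁻¹ ∂complexGaussianVec M =
      ENNReal.ofReal (1 / ((M : ℝ) - Module.finrank ℂ (Submodule.span ℂ
        (Set.range fun j => (WithLp.toLp 2 (y j) : EuclideanSpace ℂ (Fin M)))) - 1)) := by
  rw [← lintegral_inv_norm_projection_sq]
  · refine lintegral_congr fun z => ?_
    rw [← ofReal_norm, ← ENNReal.ofReal_pow (norm_nonneg _)]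
    rfl
  · have := finrank_range_le_card (R := ℂ)
      (fun j => (WithLp.toLp 2 (y j) : EuclideanSpace ℂ (Fin M)))
    exact (Nat.add_le_add_right this 2).trans hι

/-- The inverse moment is finite, and the inverse of `0` in `ENNReal` is `⊤`. -/
lemma ae_orthComponent_ne_zero (y : ι → Fin M → ℂ) (hι : Fintype.card ι + 2 ≤ M) :
    ∀ᵐ z ∂complexGaussianVec M, orthComponent y z ≠ 0 := by
  have hm : Measurable fun z => (‖orthComponent y z‖ₑ ^ 2)⁻¹ :=
    ((measurable_enorm_orthComponent.comp (measurable_id.prodMk measurable_const)).pow_const 2).inv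
  have := ae_lt_top hm (by
    rw [lintegral_inv_enorm_orthComponent_sq y hι]; exact ENNReal.ofReal_ne_top)
  filter_upwards [this] with z hz h0
  simp [h0] at hz

end Distance

/-! ### The mean of the inverse Gram matrix -/

section Random

variable {Ω : Type*} [MeasurableSpace Ω] {P : Measure Ω}

/-- The joint law is a product, so `Y` may be frozen while `X` is averaged. -/
lemma lintegral_comp_of_indepFun [IsProbabilityMeasure P] {α β : Type*} [MeasurableSpace α] [MeasurableSpace β]
    {μ : Measure α} [IsProbabilityMeasure μ] {X : Ω → α} {Y : Ω → β} (hX : HasLaw X μ P)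
    (hY : AEMeasurable Y P) (hXY : IndepFun X Y P) {F : α × β → ENNReal} (hF : Measurable F) :
    ∫⁻ ω, F (X ω, Y ω) ∂P = ∫⁻ ω, ∫⁻ z, F (z, Y ω) ∂μ ∂P := by
  have := Measure.isProbabilityMeasure_map hY
  rw [← lintegral_map' (f := F) (g := fun ω => (X ω, Y ω)) hF.aemeasurable
    (hX.aemeasurable.prodMk hY),
    (indepFun_iff_map_prod_eq_prod_map_map hX.aemeasurable hY).1 hXY, hX.map_eq,
    lintegral_prod_symm _ hF.aemeasurable,
    lintegral_map' (hF.lintegral_prod_left').aemeasurable hY]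

lemma ae_comp_of_indepFun [IsProbabilityMeasure P] {α β : Type*} [MeasurableSpace α] [MeasurableSpace β]
    {μ : Measure α} [IsProbabilityMeasure μ] {X : Ω → α} {Y : Ω → β} (hX : HasLaw X μ P)
    (hY : AEMeasurable Y P) (hXY : IndepFun X Y P) {S : Set (α × β)} (hS : MeasurableSet S)
    (h : ∀ y, ∀ᵐ z ∂μ, (z, y) ∈ S) : ∀ᵐ ω ∂P, (X ω, Y ω) ∈ S := by
  have hp := Measure.isProbabilityMeasure_map hY
  have h1 : ∀ᵐ p ∂(P.map fun ω => (X ω, Y ω)), p ∈ S := by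
    rw [(indepFun_iff_map_prod_eq_prod_map_map hX.aemeasurable hY).1 hXY, hX.map_eq,
      Measure.ae_prod_mem_iff_ae_ae_mem hS, Measure.ae_ae_comm (p := fun z y => (z, y) ∈ S) hS]
    exact .of_forall h
  exact ae_of_ae_map (hX.aemeasurable.prodMk hY) h1

variable {M K : ℕ} {x : Ω → Fin K → Fin M → ℂ}

/-- Independent standard columns. -/
structure IsStandardColumns (x : Ω → Fin K → Fin M → ℂ) (P : Measure Ω) : Prop where
  hasLaw : ∀ i, HasLaw (fun ω => x ω i) (complexGaussianVec M) P
  indepFun : ∀ i, IndepFun (fun ω => x ω i) (fun ω (j : {j : Fin K // j ≠ i}) => x ω j) P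

lemma IsStandardColumns.aemeasurable (hx : IsStandardColumns x P) : AEMeasurable x P :=
  aemeasurable_pi_lambda _ fun i => (hx.hasLaw i).aemeasurable

lemma IsStandardColumns.aemeasurable_others (hx : IsStandardColumns x P) (i : Fin K) :
    AEMeasurable (fun ω (j : {j : Fin K // j ≠ i}) => x ω j) P :=
  aemeasurable_pi_lambda _ fun j => (hx.hasLaw j).aemeasurable

variable [IsProbabilityMeasure P]

lemma card_others_add_two_le (hKM : K < M) (i : Fin K) :
    Fintype.card {j : Fin K // j ≠ i} + 2 ≤ M := by
  have := i.2
  rw [Fintype.card_subtype_compl, Fintype.card_fin, Fintype.card_subtype_eq]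
  omega

lemma IsStandardColumns.ae_linearIndependent (hx : IsStandardColumns x P) (hKM : K < M) :
    ∀ᵐ ω ∂P, LinearIndependent ℂ
      fun i => (WithLp.toLp 2 (x ω i) : EuclideanSpace ℂ (Fin M)) := by
  have : ∀ i, ∀ᵐ ω ∂P, orthComponent (fun j : {j : Fin K // j ≠ i} => x ω j) (x ω i) ≠ 0 := by
    intro i
    have hS : MeasurableSet {p : (Fin M → ℂ) × ({j : Fin K // j ≠ i} → Fin M → ℂ) |
        orthComponent p.2 p.1 ≠ 0} := by
      have : {p : (Fin M → ℂ) × ({j : Fin K // j ≠ i} → Fin M → ℂ) |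
        orthComponent p.2 p.1 ≠ 0} = (fun p => ‖orthComponent p.2 p.1‖ₑ) ⁻¹' {0}ᶜ := by
        ext p
        simp
      rw [this]
      exact measurable_enorm_orthComponent (measurableSet_singleton 0).compl
    exact ae_comp_of_indepFun (hx.hasLaw i) (hx.aemeasurable_others i) (hx.indepFun i) hS
      fun y => ae_orthComponent_ne_zero y (card_others_add_two_le hKM i)
  filter_upwards [ae_all_iff.2 this] with ω hω
  exact linearIndependent_of_orthComponent_ne_zero hω

lemma IsStandardColumns.ae_isUnit_det_gram (hx : IsStandardColumns x P) (hKM : K < M) :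
    ∀ᵐ ω ∂P, IsUnit (gram (ofColumns (x ω))).det := by
  filter_upwards [hx.ae_linearIndependent hKM] with ω hω
  exact isUnit_det_gram hω

/-- The inverse of a complex Wishart matrix has mean `1 / (M - K)` on the diagonal. -/
lemma IsStandardColumns.integral_inv_gram (hx : IsStandardColumns x P) (hKM : K < M)
    (i : Fin K) :
    Integrable (fun ω => (gram (ofColumns (x ω)))⁻¹ i i) P ∧
      ∫ ω, (gram (ofColumns (x ω)))⁻¹ i i ∂P = ((1 / ((M : ℝ) - K) : ℝ) : ℂ) := by
  have hKM' : (K : ℝ) < M := by exact_mod_cast hKM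
  set g : Ω → ℝ := fun ω =>
    (‖orthComponent (fun j : {j : Fin K // j ≠ i} => x ω j) (x ω i)‖ ^ 2)⁻¹ with hg
  have hae : (fun ω => (gram (ofColumns (x ω)))⁻¹ i i) =ᵐ[P] fun ω => ((g ω : ℝ) : ℂ) := by
    filter_upwards [hx.ae_isUnit_det_gram hKM] with ω hω
    exact inv_gram_apply_self hω i
  have hlin : ∫⁻ ω, ENNReal.ofReal (g ω) ∂P = ENNReal.ofReal (1 / ((M : ℝ) - K)) := by
    have h1 : ∫⁻ ω, ENNReal.ofReal (g ω) ∂P =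
        ∫⁻ ω, (‖orthComponent (fun j : {j : Fin K // j ≠ i} => x ω j) (x ω i)‖ₑ ^ 2)⁻¹ ∂P := by
      refine lintegral_congr_ae ?_
      filter_upwards [hx.ae_linearIndependent hKM] with ω hω
      -- Needed because the inverse of `0` is `0` in `ℝ` but `⊤` in `ENNReal`. Were the component
      -- zero, the zero-forcing direction would vanish, against its duality with column `i`.
      have hne : orthComponent (fun j : {j : Fin K // j ≠ i} => x ω j) (x ω i) ≠ 0 := by
        intro h0
        have h1 := inv_gram_apply_self (isUnit_det_gram hω) i
        have h2 := sum_normSq_zf (isUnit_det_gram hω) i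
        rw [h1, h0] at h2
        have h3 : ∀ m, (conjMat (ofColumns (x ω)) * (gram (ofColumns (x ω)))⁻¹) m i = 0 := by
          have h4 : ∑ m, ‖(conjMat (ofColumns (x ω)) * (gram (ofColumns (x ω)))⁻¹) m i‖ ^ 2 = 0 := by
            apply Complex.ofReal_injective
            rw [h2]
            simp
          intro m
          have := (Finset.sum_eq_zero_iff_of_nonneg fun m _ => by positivity).1 h4 m
            (Finset.mem_univ m)
          simpa using this
        have h5 := dotProduct_zf (isUnit_det_gram hω) i i
        simp [h3] at h5
      rw [hg]
      simp only
      rw [ENNReal.ofReal_inv_of_pos (by positivity), ENNReal.ofReal_pow (norm_nonneg _),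
        ofReal_norm]
    rw [h1, lintegral_comp_of_indepFun (hx.hasLaw i) (hx.aemeasurable_others i) (hx.indepFun i)
      (F := fun p => (‖orthComponent p.2 p.1‖ₑ ^ 2)⁻¹)
      ((measurable_enorm_orthComponent.pow_const 2).inv)]
    -- Almost surely the other columns span dimension `K - 1`, and `M - (K - 1) - 1 = M - K`.
    have h2 : ∀ᵐ ω ∂P, ∫⁻ z, (‖orthComponent (fun j : {j : Fin K // j ≠ i} => x ω j) z‖ₑ ^ 2)⁻¹
        ∂complexGaussianVec M = ENNReal.ofReal (1 / ((M : ℝ) - K)) := by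
      filter_upwards [hx.ae_linearIndependent hKM] with ω hω
      rw [lintegral_inv_enorm_orthComponent_sq _ (card_others_add_two_le hKM i)]
      have hli := hω.comp (fun j : {j : Fin K // j ≠ i} => (j : Fin K)) Subtype.val_injective
      have hfin := finrank_span_eq_card hli
      simp only [Function.comp_def] at hfin
      rw [hfin, Fintype.card_subtype_compl, Fintype.card_fin, Fintype.card_subtype_eq,
        Nat.cast_sub (Nat.succ_le_of_lt (i.pos))]
      congr 2
      push_cast
      ring
    rw [lintegral_congr_ae h2]
    simp
  have hgm : AEStronglyMeasurable g P := by
    have : AEMeasurable (fun ω => (gram (ofColumns (x ω)))⁻¹ i i) P :=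
      (measurable_inv_gram i i).comp_aemeasurable hx.aemeasurable
    have h2 := (Complex.measurable_re.comp_aemeasurable this).aestronglyMeasurable
    refine h2.congr ?_
    filter_upwards [hae] with ω hω
    simp only [Function.comp_apply]
    rw [hω, Complex.ofReal_re]
  have hgnn : 0 ≤ᵐ[P] g := .of_forall fun ω => by positivity
  have hgi : Integrable g P := by
    refine (lintegral_ofReal_ne_top_iff_integrable hgm hgnn).1 ?_
    rw [hlin]
    exact ENNReal.ofReal_ne_top
  refine ⟨(hgi.ofReal (𝕜 := ℂ)).congr hae.symm, ?_⟩
  rw [integral_congr_ae hae, integral_complex_ofReal, integral_eq_lintegral_of_nonneg_ae hgnn hgm,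
    hlin, ENNReal.toReal_ofReal]
  exact div_nonneg zero_le_one (by linarith)

end Random

/-- The variance of the own gain is `(S + v) - S = v`, the same as each interference moment, so both
merge into `v` times the full sum. -/
lemma sinr_eq_of_moments {Ω : Type*} [MeasurableSpace Ω] {P : Measure Ω} {M K : ℕ} 
    {ε β : Fin K → ℝ} {g : Ω → Fin M → ℂ}
    {V : Ω → Matrix (Fin M) (Fin K) ℂ} {k : Fin K} {S v : ℝ}
    (h1 : ‖∫ ω, gain g V k ω ∂P‖ ^ 2 = S)
    (h2 : ∀ i, ∫ ω, ‖gain g V i ω‖ ^ 2 ∂P = (if i = k then S else 0) + v) :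
    sinr P ε β g V k = ε k * β k * S / (1 + v * ∑ i, ε i * β i) := by
  rw [sinr, h1, h2 k, if_pos rfl]
  have h3 : ∑ i ∈ Finset.univ.erase k, ε i * β i * ∫ ω, ‖gain g V i ω‖ ^ 2 ∂P =
      ∑ i ∈ Finset.univ.erase k, ε i * β i * v := by
    refine Finset.sum_congr rfl fun i hi => ?_
    rw [h2 i, if_neg (Finset.ne_of_mem_erase hi), zero_add]
  rw [h3, ← Finset.add_sum_erase Finset.univ (fun i => ε i * β i) (Finset.mem_univ k), mul_add,
    Finset.mul_sum]
  congr 1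
  have h4 : ∑ i ∈ Finset.univ.erase k, ε i * β i * v =
      ∑ i ∈ Finset.univ.erase k, v * (ε i * β i) :=
    Finset.sum_congr rfl fun i _ => mul_comm _ _
  rw [h4]
  ring

/-! ### Moments of precoded gains -/

section Precoding

variable {Ω : Type*} [MeasurableSpace Ω] {P : Measure Ω} [IsProbabilityMeasure P] {M K : ℕ}
  {x : Ω → Fin K → Fin M → ℂ}

/-- Moments of the gain of a precoder that depends on the columns `x` only, for a channel
`a x_k + R` whose innovation `R` is white and independent of `x`. -/
lemma moments_gain {k : Fin K} {g R : Ω → Fin M → ℂ} {a v : ℝ} (hR : IsWhite R v P)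
    (hind : IndepFun R x P) (hg : ∀ᵐ ω ∂P, g ω = a • x ω k + R ω)
    {f : (Fin K → Fin M → ℂ) → Fin M → ℂ} (hf : Measurable f)
    (hf2 : ∀ m, MemLp (fun ω => f (x ω) m) 2 P)
    (hxf : MemLp (fun ω => x ω k ⬝ᵥ f (x ω)) 2 P) :
    MemLp (fun ω => g ω ⬝ᵥ f (x ω)) 2 P ∧
    ∫ ω, g ω ⬝ᵥ f (x ω) ∂P = a * ∫ ω, x ω k ⬝ᵥ f (x ω) ∂P ∧
    ∫ ω, ‖g ω ⬝ᵥ f (x ω)‖ ^ 2 ∂P =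
      a ^ 2 * ∫ ω, ‖x ω k ⬝ᵥ f (x ω)‖ ^ 2 ∂P + v * ∫ ω, ∑ m, ‖f (x ω) m‖ ^ 2 ∂P := by
  have hdm : Measurable fun y : Fin K → Fin M → ℂ => (a : ℂ) * (y k ⬝ᵥ f y) := by
    unfold dotProduct
    fun_prop
  have hind' : IndepFun R (fun ω => ((a : ℂ) * (x ω k ⬝ᵥ f (x ω)), f (x ω))) P :=
    hind.comp measurable_id (hdm.prodMk hf)
  obtain ⟨h1, h2, h3⟩ := moments_add_dotProduct_of_indepFun hR (hxf.const_mul (a : ℂ)) hf2 hind'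
  have hae : (fun ω => g ω ⬝ᵥ f (x ω)) =ᵐ[P]
      fun ω => (a : ℂ) * (x ω k ⬝ᵥ f (x ω)) + R ω ⬝ᵥ f (x ω) := by
    filter_upwards [hg] with ω hω
    rw [hω, add_dotProduct, smul_dotProduct, Complex.real_smul]
  refine ⟨(memLp_congr_ae hae).2 h1, ?_, ?_⟩
  · rw [integral_congr_ae hae, h2, integral_const_mul]
  · have hae2 : (fun ω => ‖g ω ⬝ᵥ f (x ω)‖ ^ 2) =ᵐ[P]
        fun ω => ‖(a : ℂ) * (x ω k ⬝ᵥ f (x ω)) + R ω ⬝ᵥ f (x ω)‖ ^ 2 := by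
      filter_upwards [hae] with ω hω
      rw [hω]
    rw [integral_congr_ae hae2, h3]
    simp_rw [norm_mul, mul_pow]
    rw [integral_const_mul]
    simp

section MatchedFilter

lemma integral_sum_normSq {X : Ω → Fin M → ℂ} (hX : HasLaw X (complexGaussianVec M) P) :
    ∫ ω, ∑ m, ‖X ω m‖ ^ 2 ∂P = M := by
  rw [integral_finsetSum]
  · simp [integral_normSq_eval hX]
  · intro m _
    exact ((memLp_eval hX m).mono_exponent (by norm_num : (2 : ENNReal) ≤ 4)).integrable_norm_pow
      (p := 2) (by norm_num)

lemma dotProduct_conj_self (z : Fin M → ℂ) :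
    (z ⬝ᵥ fun m => (starRingEnd ℂ) (z m)) = ((∑ m, ‖z m‖ ^ 2 : ℝ) : ℂ) := by
  simp [dotProduct, Complex.mul_conj']

lemma trace_gram_ofColumns (y : Fin K → Fin M → ℂ) :
    (gram (ofColumns y)).trace = ∑ i, ((∑ m, ‖y i m‖ ^ 2 : ℝ) : ℂ) := by
  refine Finset.sum_congr rfl fun i _ => ?_
  rw [← dotProduct_conj_self]
  rfl

/-- Moments of the inner products of the columns. -/
lemma IsStandardColumns.moments_dotProduct_conj (hx : IsStandardColumns x P) (k i : Fin K) :
    MemLp (fun ω => x ω k ⬝ᵥ fun m => (starRingEnd ℂ) (x ω i m)) 2 P ∧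
    ∫ ω, (x ω k ⬝ᵥ fun m => (starRingEnd ℂ) (x ω i m)) ∂P = (if i = k then (M : ℂ) else 0) ∧
    ∫ ω, ‖x ω k ⬝ᵥ fun m => (starRingEnd ℂ) (x ω i m)‖ ^ 2 ∂P =
      (if i = k then (M : ℝ) ^ 2 else 0) + M := by
  split_ifs with hik
  · subst hik
    simp_rw [dotProduct_conj_self]
    refine ⟨(memLp_sum_normSq (hx.hasLaw i)).ofReal, ?_, ?_⟩
    · rw [integral_complex_ofReal, integral_sum_normSq (hx.hasLaw i)]
      simp
    · rw [← integral_sum_normSq_sq (hx.hasLaw i)]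
      simp_rw [Complex.norm_real, Real.norm_eq_abs, sq_abs]
  -- For `i ≠ k` the column `x_k` itself is the white vector, independent of `conj x_i`, and the
  -- additive term `X` is `0`.
  · have hwhite : IsWhite (fun ω => x ω k) (1 ^ 2) P := by
      refine isWhite_of_hasLaw ?_
      rw [scaledGaussianVec_one]
      exact hx.hasLaw k
    have hL : ∀ m, MemLp (fun ω => (starRingEnd ℂ) (x ω i m)) 2 P := fun m =>
      (((memLp_eval (hx.hasLaw i) m).mono_exponent (by norm_num : (2 : ENNReal) ≤ 4))).star
    have hind : IndepFun (fun ω => x ω k)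
        (fun ω => ((0 : ℂ), fun m => (starRingEnd ℂ) (x ω i m))) P := by
      refine (hx.indepFun k).comp (φ := id)
        (ψ := fun y => ((0 : ℂ), fun m => (starRingEnd ℂ) (y ⟨i, hik⟩ m))) measurable_id ?_
      exact Continuous.measurable (by fun_prop)
    have := moments_add_dotProduct_of_indepFun hwhite (MemLp.zero' (p := 2)) hL hind
    simpa [integral_sum_normSq (hx.hasLaw i)] using this

end MatchedFilter

section ZeroForcing

lemma IsStandardColumns.moments_zf (hx : IsStandardColumns x P) (hKM : K < M) (i : Fin K) :
    (∀ m, MemLp (fun ω => (conjMat (ofColumns (x ω)) * (gram (ofColumns (x ω)))⁻¹) m i) 2 P) ∧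
    ∫ ω, ∑ m, ‖(conjMat (ofColumns (x ω)) * (gram (ofColumns (x ω)))⁻¹) m i‖ ^ 2 ∂P =
      1 / ((M : ℝ) - K) := by
  obtain ⟨hi, hv⟩ := hx.integral_inv_gram hKM i
  have hae : (fun ω => ((∑ m, ‖(conjMat (ofColumns (x ω)) *
      (gram (ofColumns (x ω)))⁻¹) m i‖ ^ 2 : ℝ) : ℂ)) =ᵐ[P]
      fun ω => (gram (ofColumns (x ω)))⁻¹ i i := by
    filter_upwards [hx.ae_isUnit_det_gram hKM] with ω hω
    exact sum_normSq_zf hω i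
  have hmeas : ∀ m, AEStronglyMeasurable
      (fun ω => (conjMat (ofColumns (x ω)) * (gram (ofColumns (x ω)))⁻¹) m i) P := fun m =>
    ((measurable_zf m i).comp_aemeasurable hx.aemeasurable).aestronglyMeasurable
  constructor
  · intro m
    rw [memLp_two_iff_integrable_sq_norm (hmeas m)]
    refine (hi.congr hae.symm).mono ((hmeas m).norm.pow 2) (.of_forall fun ω => ?_)
    rw [Complex.norm_real]
    have h1 := Finset.single_le_sum (f := fun m => ‖(conjMat (ofColumns (x ω)) *
      (gram (ofColumns (x ω)))⁻¹) m i‖ ^ 2) (fun m _ => by positivity) (Finset.mem_univ m)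
    rw [Real.norm_of_nonneg (by positivity), Real.norm_of_nonneg (by positivity)]
    exact h1
  · apply Complex.ofReal_injective
    rw [← hv, ← integral_congr_ae hae, integral_complex_ofReal]

lemma IsStandardColumns.integral_trace_inv_gram (hx : IsStandardColumns x P) (hKM : K < M) :
    Integrable (fun ω => ((gram (ofColumns (x ω)))⁻¹).trace) P ∧
    ∫ ω, ((gram (ofColumns (x ω)))⁻¹).trace ∂P = ((K * (1 / ((M : ℝ) - K)) : ℝ) : ℂ) := by
  have h := fun i => hx.integral_inv_gram hKM i
  unfold Matrix.trace
  simp only [Matrix.diag_apply]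
  refine ⟨integrable_finsetSum _ fun i _ => (h i).1, ?_⟩
  rw [integral_finsetSum _ fun i _ => (h i).1]
  simp_rw [(h _).2]
  simp

end ZeroForcing

end Precoding

/-! ### The two SINR values -/

section Main

variable {Ω : Type*} [MeasurableSpace Ω] {P : Measure Ω} [IsProbabilityMeasure P] {M K : ℕ}
  {x : Ω → Fin K → Fin M → ℂ} {k : Fin K} {g R : Ω → Fin M → ℂ} {a : ℝ} {ε β : Fin K → ℝ}

lemma IsStandardColumns.mfNorm_eq (hx : IsStandardColumns x P) (hK : 0 < K) :
    Integrable (fun ω => (gram (ofColumns (x ω))).trace) P ∧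
      mfNorm P (fun ω => ofColumns (x ω)) = M := by
  have hi : ∀ i, Integrable (fun ω => ((∑ m, ‖x ω i m‖ ^ 2 : ℝ) : ℂ)) P := fun i =>
    ((memLp_sum_normSq (hx.hasLaw i)).integrable (by simp)).ofReal
  constructor
  · simp_rw [trace_gram_ofColumns]
    exact integrable_finsetSum _ fun i _ => hi i
  · unfold mfNorm
    simp_rw [trace_gram_ofColumns]
    rw [integral_finsetSum _ fun i _ => hi i]
    simp_rw [integral_complex_ofReal, integral_sum_normSq (hx.hasLaw _)]
    have : (K : ℝ) ≠ 0 := by positivity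
    simp
    field_simp

lemma IsStandardColumns.mf_gain (hx : IsStandardColumns x P) (hM : 0 < M)
    (hR : IsWhite R (1 - a ^ 2) P) (hind : IndepFun R x P)
    (hg : ∀ᵐ ω ∂P, g ω = a • x ω k + R ω) :
    (∀ i, MemLp (gain g (mfPrecoder P fun ω => ofColumns (x ω)) i) 2 P) ∧
    sinr P ε β g (mfPrecoder P fun ω => ofColumns (x ω)) k =
      ε k * β k * M * a ^ 2 / (1 + ∑ i, ε i * β i) := by
  have hM' : (0 : ℝ) < M := by exact_mod_cast hM
  have hη := (hx.mfNorm_eq k.pos).2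
  set c : ℂ := ((1 / √(M : ℝ) : ℝ) : ℂ) with hc
  have hcsq : ‖c‖ ^ 2 = 1 / M := by
    rw [hc, Complex.norm_real, Real.norm_eq_abs, sq_abs, div_pow, one_pow, Real.sq_sqrt hM'.le]
  let f : Fin K → (Fin K → Fin M → ℂ) → Fin M → ℂ := fun i y m => c * (starRingEnd ℂ) (y i m)
  have hgain : ∀ i ω, gain g (mfPrecoder P fun ω => ofColumns (x ω)) i ω = g ω ⬝ᵥ f i (x ω) := by
    intro i ω
    rw [gain, mfPrecoder, hη]
    rfl
  have hf : ∀ i, Measurable (f i) := fun i => Continuous.measurable (by fun_prop)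
  have hdot : ∀ i ω, x ω k ⬝ᵥ f i (x ω) = c * (x ω k ⬝ᵥ fun m => (starRingEnd ℂ) (x ω i m)) := by
    intro i ω
    simp only [f, dotProduct, Finset.mul_sum]
    exact Finset.sum_congr rfl fun m _ => by ring
  have hmom := fun i => moments_gain (f := f i) hR hind hg (hf i)
    (fun m => (((memLp_eval (hx.hasLaw i) m).mono_exponent
      (by norm_num : (2 : ENNReal) ≤ 4))).star.const_mul c)
    (by simp_rw [hdot]; exact (hx.moments_dotProduct_conj k i).1.const_mul c)
  have hV : ∀ i, ∫ ω, ∑ m, ‖f i (x ω) m‖ ^ 2 ∂P = 1 := by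
    intro i
    simp only [f, norm_mul, mul_pow, RCLike.norm_conj, ← Finset.mul_sum]
    rw [integral_const_mul, integral_sum_normSq (hx.hasLaw i), hcsq]
    field_simp
  constructor
  · intro i
    exact (memLp_congr_ae (.of_forall (hgain i))).2 (hmom i).1
  -- The second moments are `a² (M δ_{ik} + 1) + (1 - a²)`: the residual restores exactly the power
  -- lost by ageing, so `v` does not depend on the age.
  · rw [sinr_eq_of_moments (S := M * a ^ 2) (v := 1)]
    · ring
    · simp_rw [hgain, (hmom k).2.1, hdot]
      rw [integral_const_mul, (hx.moments_dotProduct_conj k k).2.1, if_pos rfl, norm_mul, norm_mul,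
        mul_pow, mul_pow, hcsq]
      simp
      field_simp
    · intro i
      simp_rw [hgain, (hmom i).2.2, hdot, norm_mul, mul_pow]
      rw [integral_const_mul, (hx.moments_dotProduct_conj k i).2.2, hV, hcsq]
      split_ifs <;> field_simp <;> ring

lemma IsStandardColumns.zfNorm_eq (hx : IsStandardColumns x P) (hKM : K < M) (hK : 0 < K) :
    zfNorm P (fun ω => ofColumns (x ω)) = 1 / ((M : ℝ) - K) := by
  rw [zfNorm, (hx.integral_trace_inv_gram hKM).2, Complex.ofReal_re]
  have : (K : ℝ) ≠ 0 := by positivity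
  field_simp

lemma IsStandardColumns.zf_gain (hx : IsStandardColumns x P) (hKM : K < M)
    (hR : IsWhite R (1 - a ^ 2) P) (hind : IndepFun R x P)
    (hg : ∀ᵐ ω ∂P, g ω = a • x ω k + R ω) :
    (∀ i, MemLp (gain g (zfPrecoder P fun ω => ofColumns (x ω)) i) 2 P) ∧
    sinr P ε β g (zfPrecoder P fun ω => ofColumns (x ω)) k =
      ε k * β k * ((M : ℝ) - K) * a ^ 2 / (1 + (1 - a ^ 2) * ∑ i, ε i * β i) := by
  have hKM' : (0 : ℝ) < M - K := by
    have : (K : ℝ) < M := by exact_mod_cast hKM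
    linarith
  have hη := hx.zfNorm_eq hKM k.pos
  set c : ℂ := ((1 / √(1 / ((M : ℝ) - K)) : ℝ) : ℂ) with hc
  have hcsq : ‖c‖ ^ 2 = M - K := by
    rw [hc, Complex.norm_real, Real.norm_eq_abs, sq_abs, div_pow, one_pow,
      Real.sq_sqrt (by positivity), one_div_one_div]
  let f : Fin K → (Fin K → Fin M → ℂ) → Fin M → ℂ := fun i y m =>
    c * (conjMat (ofColumns y) * (gram (ofColumns y))⁻¹) m i
  have hgain : ∀ i ω, gain g (zfPrecoder P fun ω => ofColumns (x ω)) i ω = g ω ⬝ᵥ f i (x ω) := by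
    intro i ω
    rw [gain, zfPrecoder, hη]
    rfl
  have hf : ∀ i, Measurable (f i) := fun i =>
    measurable_pi_lambda _ fun m => (measurable_zf m i).const_mul c
  have hdot : ∀ i, (fun ω => x ω k ⬝ᵥ f i (x ω)) =ᵐ[P] fun _ => c * if k = i then 1 else 0 := by
    intro i
    filter_upwards [hx.ae_isUnit_det_gram hKM] with ω hω
    rw [← dotProduct_zf hω]
    simp only [f, dotProduct, Finset.mul_sum]
    exact Finset.sum_congr rfl fun m _ => by ring
  have hmom := fun i => moments_gain (f := f i) hR hind hg (hf i)
    (fun m => ((hx.moments_zf hKM i).1 m).const_mul c)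
    ((memLp_congr_ae (hdot i)).2 (memLp_const _))
  have hV : ∀ i, ∫ ω, ∑ m, ‖f i (x ω) m‖ ^ 2 ∂P = 1 := by
    intro i
    simp only [f, norm_mul, mul_pow, ← Finset.mul_sum]
    rw [integral_const_mul, (hx.moments_zf hKM i).2, hcsq]
    field_simp
  constructor
  · intro i
    exact (memLp_congr_ae (.of_forall (hgain i))).2 (hmom i).1
  -- The estimated part of the gain is almost surely constant, so only the residual contributes to
  -- `v`.
  · rw [sinr_eq_of_moments (S := (M - K) * a ^ 2) (v := 1 - a ^ 2)]
    · ring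
    · simp_rw [hgain, (hmom k).2.1]
      rw [integral_congr_ae (hdot k)]
      simp [mul_pow, hcsq]
      ring
    · intro i
      have h2 : (fun ω => ‖x ω k ⬝ᵥ f i (x ω)‖ ^ 2) =ᵐ[P]
          fun _ => (if i = k then (M - K : ℝ) else 0) := by
        filter_upwards [hdot i] with ω hω
        rw [hω]
        by_cases hik : i = k
        · subst hik; simp [hcsq]
        · simp [hik, Ne.symm hik]
      simp_rw [hgain, (hmom i).2.2]
      rw [integral_congr_ae h2, hV]
      split_ifs <;> simp [mul_comm]

end Main

end AgedCSI

theorem theorem1 {Ω : Type*} [MeasurableSpace Ω] (P : Measure Ω) [IsProbabilityMeasure P]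
    (M K : ℕ) (hM : 0 < M) (ε β ρ : Fin K → ℝ)
    (hε : ∀ i, 0 ≤ ε i) (hβ : ∀ i, 0 ≤ β i) (hρ : ∀ i, |ρ i| ≤ 1)
    (h e : Fin K → ℕ → Ω → Fin M → ℂ) (hch : AgedCSI.IsGaussMarkovChannel P ρ h e)
    (t : ℕ) (age : Fin K → ℕ) (hage : ∀ i, age i ≤ t)
    (k : Fin K) (n : ℕ) (hn : age k = n) :
    -- matched filter: the expectations exist, and the value of the SINR bound
    (Integrable (fun ω => (AgedCSI.gram (AgedCSI.estimate h t age ω)).trace) P ∧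
      AgedCSI.mfNorm P (AgedCSI.estimate h t age) = M ∧
      (∀ i, MemLp (AgedCSI.gain (h k t)
        (AgedCSI.mfPrecoder P (AgedCSI.estimate h t age)) i) 2 P) ∧
      AgedCSI.sinr P ε β (h k t) (AgedCSI.mfPrecoder P (AgedCSI.estimate h t age)) k =
        ε k * β k * M * ρ k ^ (2 * n) / (1 + ∑ i, ε i * β i)) ∧
    -- zero forcing: the inverse and the expectations exist, and the value of the SINR bound
    (K < M →
      (∀ᵐ ω ∂P, IsUnit (AgedCSI.gram (AgedCSI.estimate h t age ω)).det) ∧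
      Integrable (fun ω => ((AgedCSI.gram (AgedCSI.estimate h t age ω))⁻¹).trace) P ∧
      AgedCSI.zfNorm P (AgedCSI.estimate h t age) = 1 / ((M : ℝ) - K) ∧
      (∀ i, MemLp (AgedCSI.gain (h k t)
        (AgedCSI.zfPrecoder P (AgedCSI.estimate h t age)) i) 2 P) ∧
      AgedCSI.sinr P ε β (h k t) (AgedCSI.zfPrecoder P (AgedCSI.estimate h t age)) k =
        ε k * β k * ((M : ℝ) - K) * ρ k ^ (2 * n) /
          (1 + (1 - ρ k ^ (2 * n)) * ∑ i, ε i * β i)) := by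
  subst hn
  set x : Ω → Fin K → Fin M → ℂ := fun ω i => h i (t - age i) ω with hxdef
  have hx : AgedCSI.IsStandardColumns x P :=
    ⟨fun i => hch.hasLaw hρ i _, fun i => hch.indepFun_others (fun j => t - age j) i⟩
  obtain ⟨R, hR, hind, hg⟩ := hch.exists_residual hρ (fun j => t - age j) k (age k)
  -- Subtraction of blocks is truncated: `age k ≤ t` is what makes the decomposition end at block
  -- `t`.
  rw [Nat.sub_add_cancel (hage k)] at hg
  have hsq : √(1 - ρ k ^ (2 * age k)) ^ 2 = 1 - (ρ k ^ age k) ^ 2 := by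
    rw [← pow_mul, mul_comm (age k) 2, Real.sq_sqrt]
    rw [pow_mul, sub_nonneg]
    exact pow_le_one₀ (sq_nonneg _) ((sq_le_one_iff_abs_le_one _).2 (hρ k))
  have hwhite := AgedCSI.isWhite_of_hasLaw hR
  rw [hsq] at hwhite
  have hest : AgedCSI.estimate h t age = fun ω => AgedCSI.ofColumns (x ω) := rfl
  rw [hest, mul_comm 2, pow_mul]
  obtain ⟨m1, m2⟩ := hx.mf_gain (ε := ε) (β := β) hM hwhite hind hg
  refine ⟨⟨(hx.mfNorm_eq k.pos).1, (hx.mfNorm_eq k.pos).2, m1, m2⟩, fun hKM => ?_⟩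
  obtain ⟨z1, z2⟩ := hx.zf_gain (ε := ε) (β := β) hKM hwhite hind hg
  exact ⟨hx.ae_isUnit_det_gram hKM, (hx.integral_trace_inv_gram hKM).1,
    hx.zfNorm_eq hKM k.pos, z1, z2⟩
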